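/- A partition is strict if its parts are pairwise distinct, and odd if all its parts are odd; $\ell(\lambda)$ and $|\lambda|$ denote the number of parts and the size of $\lambda$, and the empty partition $\emptyset$ is both strict and odd. Let $\mathcal{SP}_N$ be the set of strict partitions of $N$. The shifted diagram of a strict partition $\lambda$ is $S(\lambda)=\{(i,j): 1\le i\le \ell(\lambda),\ i\le j\le \lambda_i+i-1\}$. For strict partitions $\lambda,\mu$, let $g^{\lambda/\mu}$ be the number of sequences of strict partitions $(\lambda^{(0)},\dots,\lambda^{(k)})$, $k=|\lambda|-|\mu|$, with $\lambda^{(0)}=\mu$, $\lambda^{(k)}=\lambda$, such that each $S(\lambda^{(i)})$ is obtained from $S(\lambda^{(i-1)})$ by adding exactly one box ($g^{\lambda/\mu}=0$ unless $S(\mu)\subseteq S(\lambda)$), and let $g^\lambda=g^{\lambda/\emptyset}$. For a strict partition $\mu$ of $m$ and an integer $n\ge 0$ put $$\mathbb{P}_{\mu,n}(\lambda)=\frac{m!}{(n+m)!}\,2^{\,n-\ell(\lambda)+\ell(\mu)}\,\frac{g^\lambda}{g^\mu}\,g^{\lambda/\mu}\quad(\lambda\in\mathcal{SP}_{n+m}),\qquad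 \mathbb{E}_{\mu,n}[\varphi]=\sum_{\lambda\in\mathcal{SP}_{n+m}}\mathbb{P}_{\mu,n}(\lambda)\,\varphi(\lambda).$$ Let $\Gamma$ be the $\mathbb{Q}$-algebra of symmetric functions generated by the power sums $p_1,p_3,p_5,\dots$; for $f\in\Gamma$ write $f(\lambda)=f(\lambda_1,\dots,\lambda_{\ell(\lambda)},0,0,\dots)$, and for an odd partition $\rho$ put $p_\rho=p_{\rho_1}p_{\rho_2}\cdots$. For a strict partition $\lambda$ of length $l$, the Schur $P$-function $P_\lambda$ is given in $N\ge l$ variables by $$\frac{1}{(N-l)!}\sum_{\omega\in S_N}\omega\Big(x_1^{\lambda_1}\cdots x_l^{\lambda_l}\prod_{1\le i\le l,\ i<j\le N}\frac{x_i+x_j}{x_i-x_j}\Big)$$ and by $0$ in $N<l$ variables; the factorial Schur $P$-function $P^*_\lambda$ is defined in the same way with each $x_i^{\lambda_i}$ replaced by $x_i(x_i-1)\cdots(x_i-\lambda_i+1)$. **Theorem.** There is a unique linear isomorphism $\Psi:\Gamma\to\Gamma$ with $\Psi(P_\lambda)=P^*_\lambda$ for all strict partitions $\lambda$. Put $\mathfrak{p}_\rho=\Psi(p_\rho)$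 for odd partitions $\rho$. If $\rho$ is an odd partition with no part equal to $1$, then for every strict partition $\mu$ and every $n\ge 0$ $$\mathbb{E}_{\mu,n}[\mathfrak{p}_\rho]=\mathfrak{p}_\rho(\mu).$$ Moreover $\mathbb{P}_{\mu,n}$ is a probability measure on $\mathcal{SP}_{n+m}$, where $m=|\mu|$: it is nonnegative and $\sum_{\lambda\in\mathcal{SP}_{n+m}}\mathbb{P}_{\mu,n}(\lambda)=1$ (the case $\rho=\emptyset$). -/

import Mathlib

open Finset

namespace ShiftedPlancherel

/-! ### Strict partitions, shifted diagrams, standard tableaux -/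

/-- A strict partition: a strictly decreasing finite sequence of positive integers. -/
@[ext]
structure StrictPartition where
  parts : List ℕ
  decreasing : parts.Pairwise (· > ·)
  pos : ∀ a ∈ parts, 0 < a

namespace StrictPartition

/-- The length `ℓ(λ)`. -/
def length (lam : StrictPartition) : ℕ := lam.parts.length

/-- The size `|λ|`. -/
def size (lam : StrictPartition) : ℕ := lam.parts.sum

/-- `lam.part i` is the part `λ_{i+1}` (rows are counted from zero here), and it is `0` for
`i ≥ ℓ(λ)`. -/
def part (lam : StrictPartition) (i : ℕ) : ℕ := lam.parts.getD i 0

/-- The empty partition. -/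
def empty : StrictPartition := ⟨[], List.Pairwise.nil, by simp⟩

/-- The shifted Young diagram `S(λ)`, with rows and columns counted from zero: row `i` consists of
the boxes `(i, i), (i, i + 1), …, (i, i + λ_{i+1} - 1)`. -/
def diagram (lam : StrictPartition) : Set (ℕ × ℕ) :=
  {b | b.1 < lam.length ∧ b.1 ≤ b.2 ∧ b.2 < lam.part b.1 + b.1}

theorem finite_size (n : ℕ) : {lam : StrictPartition | lam.size = n}.Finite := by
  refine Set.Finite.of_finite_image (f := fun lam => lam.parts.toFinset) ?_ ?_
  · refine ((Finset.range (n + 1)).powerset.finite_toSet).subset ?_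
    rintro _ ⟨lam, h, rfl⟩
    simp only [Finset.coe_powerset, Set.mem_preimage, Set.mem_powerset_iff]
    intro a ha
    have ha' : a ∈ lam.parts := by simpa using ha
    have := List.single_le_sum (fun x _ => Nat.zero_le x) a ha'
    simp only [size, Set.mem_ofPred_eq] at h
    simp only [Finset.coe_range, Set.mem_Iio]
    omega
  · intro a _ b _ hab
    ext1
    have ha : a.parts.Nodup := a.decreasing.imp (fun h => (ne_of_gt h))
    have hb : b.parts.Nodup := b.decreasing.imp (fun h => (ne_of_gt h))
    exact List.Perm.eq_of_pairwise' a.decreasing b.decreasing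
      (List.perm_of_nodup_nodup_toFinset_eq ha hb hab)

end StrictPartition

/-- The finite set `SP_n` of strict partitions of `n`. -/
noncomputable def SP (n : ℕ) : Finset StrictPartition :=
  (StrictPartition.finite_size n).toFinset

theorem mem_SP {n : ℕ} {lam : StrictPartition} : lam ∈ SP n ↔ lam.size = n := by
  simp [SP]

/-- `t = (t 0, …, t k)` is a standard tableau of shape `S(λ/μ)`: it starts at `μ`, ends at `λ`, and
each diagram is obtained from the preceding one by adding exactly one box. -/
def IsStandardTableau (lam mu : StrictPartition) {k : ℕ} (t : Fin (k + 1) → StrictPartition) :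
    Prop :=
  t 0 = mu ∧ t (Fin.last k) = lam ∧
    ∀ i : Fin k, ∃ b : ℕ × ℕ, b ∉ (t i.castSucc).diagram ∧
      (t i.succ).diagram = insert b (t i.castSucc).diagram

/-- The number `g^{λ/μ}` of standard tableaux of shape `S(λ/μ)`. There is no such tableau, so that
`g^{λ/μ} = 0`, unless `S(μ) ⊆ S(λ)`. -/
noncomputable def gSkew (lam mu : StrictPartition) : ℕ :=
  Nat.card {t : Fin (lam.size - mu.size + 1) → StrictPartition // IsStandardTableau lam mu t}

/-- `g^λ = g^{λ/∅}`. -/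
noncomputable def gStd (lam : StrictPartition) : ℕ := gSkew lam StrictPartition.empty

/-! ### The measure `P_{μ,n}` and the average `E_{μ,n}` -/

/-- The weight `P_{μ,n}(λ)`, with `m = |μ|`. -/
noncomputable def plancherelWeight (mu : StrictPartition) (n : ℕ) (lam : StrictPartition) : ℚ :=
  (mu.size.factorial : ℚ) / ((n + mu.size).factorial : ℚ) *
    (2 : ℚ) ^ ((n : ℤ) - (lam.length : ℤ) + (mu.length : ℤ)) *
    ((gStd lam : ℚ) / (gStd mu : ℚ)) * (gSkew lam mu : ℚ)

/-- `E_{μ,n}[φ] = ∑_{λ ∈ SP_{n+m}} P_{μ,n}(λ) φ(λ)`, with `m = |μ|`. -/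
noncomputable def average (mu : StrictPartition) (n : ℕ) (φ : StrictPartition → ℚ) : ℚ :=
  ∑ lam ∈ SP (n + mu.size), plancherelWeight mu n lam * φ lam

/-! ### Supersymmetric functions -/

/-- Sequences `(F_N)` of polynomials, `F_N` in `N` variables, under componentwise operations.
Symmetric functions are the sequences in which each `F_N` is symmetric and
`F_{N+1}(x_1, …, x_N, 0) = F_N(x_1, …, x_N)`. (The component `N = 0` is determined by the
others.) -/
abbrev PolySeq : Type := (N : ℕ) → MvPolynomial (Fin N) ℚ

/-- The power sum `p_r = x_1^r + x_2^r + ⋯`. -/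
noncomputable def powerSum (r : ℕ) : PolySeq := fun N => MvPolynomial.psum (Fin N) ℚ r

/-- The algebra `Γ` of supersymmetric functions, generated by `p_1, p_3, p_5, …`. -/
noncomputable def Gam : Subalgebra ℚ PolySeq :=
  Algebra.adjoin ℚ (Set.range fun m : ℕ => powerSum (2 * m + 1))

/-- The value `f(λ) = f(λ_1, …, λ_l, 0, 0, …)`, `l = ℓ(λ)`: by stability it is the value of the
component of `f` in `l` variables at `(λ_1, …, λ_l)`. -/
noncomputable def evalAt (f : PolySeq) (lam : StrictPartition) : ℚ :=
  MvPolynomial.eval (fun i : Fin lam.length => (lam.part i : ℚ)) (f lam.length)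

/-- An odd partition: a finite multiset of odd (hence positive) integers, its parts. -/
@[ext]
structure OddPartition where
  parts : Multiset ℕ
  odd : ∀ r ∈ parts, Odd r

theorem prod_powerSum_mem (rho : OddPartition) : (rho.parts.map powerSum).prod ∈ Gam := by
  refine Subalgebra.multiset_prod_mem _ ?_
  intro f hf
  obtain ⟨r, hr, rfl⟩ := Multiset.mem_map.1 hf
  obtain ⟨m, rfl⟩ := rho.odd r hr
  exact Algebra.subset_adjoin ⟨m, rfl⟩

/-- `p_ρ = p_{ρ_1} p_{ρ_2} ⋯ p_{ρ_l}` for an odd partition `ρ`. -/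
noncomputable def oddPowerSum (rho : OddPartition) : Gam :=
  ⟨(rho.parts.map powerSum).prod, prod_powerSum_mem rho⟩

/-! ### Schur `P`-functions and factorial Schur `P`-functions -/

/-- The field of rational functions in `x_1, …, x_N`. -/
abbrev RatFun (N : ℕ) : Type := FractionRing (MvPolynomial (Fin N) ℚ)

/-- The variable with index `i`, as a rational function. -/
noncomputable def ratVar {N : ℕ} (i : Fin N) : RatFun N :=
  algebraMap (MvPolynomial (Fin N) ℚ) (RatFun N) (MvPolynomial.X i)

/-- The image under the permutation `ω` of the variables of
`u_{λ_1}(x_1) ⋯ u_{λ_l}(x_l) ∏_{i ≤ l, i < j ≤ N} (x_i + x_j) / (x_i - x_j)`,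
for a family `(u_k)` of polynomials in one variable. -/
noncomputable def schurTerm (u : ℕ → Polynomial ℚ) (lam : StrictPartition) (N : ℕ)
    (ω : Equiv.Perm (Fin N)) : RatFun N :=
  (∏ i ∈ univ.filter (fun i : Fin N => (i : ℕ) < lam.length), Polynomial.aeval (ratVar (ω i)) (u (lam.part i))) *
    ∏ i ∈ univ.filter (fun i : Fin N => (i : ℕ) < lam.length), ∏ j ∈ Ioi i,
      (ratVar (ω i) + ratVar (ω j)) / (ratVar (ω i) - ratVar (ω j))

/-- `1 / (N - l)! ∑_{ω ∈ S_N} ω (u_{λ_1}(x_1) ⋯ u_{λ_l}(x_l) ∏ (x_i + x_j) / (x_i - x_j))` if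
`l = ℓ(λ) ≤ N`, and `0` otherwise. -/
noncomputable def schurRat (u : ℕ → Polynomial ℚ) (lam : StrictPartition) (N : ℕ) : RatFun N :=
  if lam.length ≤ N then
    (1 / ((N - lam.length).factorial : RatFun N)) *
      ∑ ω : Equiv.Perm (Fin N), schurTerm u lam N ω
  else 0

section Polynomiality

open MvPolynomial

variable {N : ℕ}

/-- Substitute `x_i` for `x_j`. -/
noncomputable def ident (i j : Fin N) : MvPolynomial (Fin N) ℚ →ₐ[ℚ] MvPolynomial (Fin N) ℚ :=
  aeval (fun k => if k = j then X i else X k)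

theorem dvd_sub_ident (i j : Fin N) (f : MvPolynomial (Fin N) ℚ) :
    (X i - X j : MvPolynomial (Fin N) ℚ) ∣ f - ident i j f := by
  induction f using MvPolynomial.induction_on with
  | C a => simp [ident, MvPolynomial.algebraMap_eq]
  | add a b ha hb =>
    have : a + b - ident i j (a + b) = (a - ident i j a) + (b - ident i j b) := by
      rw [map_add]; ring
    rw [this]; exact dvd_add ha hb
  | mul_X a k ha =>
    have : a * X k - ident i j (a * X k) =
        (a - ident i j a) * X k + ident i j a * (X k - ident i j (X k)) := by
      rw [map_mul]; ring
    rw [this]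
    refine dvd_add (ha.mul_right _) (Dvd.dvd.mul_left ?_ _)
    by_cases h : k = j
    · subst h
      simp only [ident, aeval_X, if_true]
      exact ⟨-1, by ring⟩
    · simp [ident, h]

theorem dvd_iff_ident (i j : Fin N) (f : MvPolynomial (Fin N) ℚ) :
    (X i - X j : MvPolynomial (Fin N) ℚ) ∣ f ↔ ident i j f = 0 := by
  constructor
  · rintro ⟨q, rfl⟩
    rw [map_mul]
    by_cases h : i = j <;> simp [ident, h]
  · intro h
    simpa [h] using dvd_sub_ident i j f

theorem sub_ne_zero_of_ne {i j : Fin N} (h : i ≠ j) :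
    (X i - X j : MvPolynomial (Fin N) ℚ) ≠ 0 :=
  sub_ne_zero.2 fun e => h (X_injective e)

theorem prime_sub {i j : Fin N} (h : i ≠ j) : Prime (X i - X j : MvPolynomial (Fin N) ℚ) := by
  refine ⟨sub_ne_zero_of_ne h, ?_, ?_⟩
  · intro hu
    have := (dvd_iff_ident i j 1).1 hu.dvd
    simp at this
  · intro a b hab
    rw [dvd_iff_ident, map_mul, mul_eq_zero] at hab
    simpa only [dvd_iff_ident] using hab

/-- The Vandermonde product. -/
noncomputable def vand (N : ℕ) : MvPolynomial (Fin N) ℚ :=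
  ∏ i : Fin N, ∏ j ∈ Ioi i, (X i - X j)

theorem vand_ne_zero : vand N ≠ 0 :=
  prod_ne_zero_iff.2 fun _ _ => prod_ne_zero_iff.2 fun _ hj =>
    sub_ne_zero_of_ne (mem_Ioi.1 hj).ne

theorem vand_dvd {B : MvPolynomial (Fin N) ℚ}
    (hB : ∀ i j : Fin N, i ≠ j → rename (Equiv.swap i j) B = -B) : vand N ∣ B := by
  unfold vand
  rw [Finset.prod_sigma']
  refine Finset.prod_dvd_of_isRelPrime ?_ ?_
  · rintro ⟨i, j⟩ hij ⟨k, l⟩ hkl hne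
    simp only [coe_sigma, Set.mem_sigma_iff, coe_univ, Set.mem_univ, true_and, mem_coe,
      mem_Ioi] at hij hkl
    refine ((prime_sub hij.ne).irreducible.isRelPrime_iff_not_dvd).2 ?_
    simp only [dvd_iff_ident]
    intro h
    simp only [ident, map_sub, aeval_X] at h
    apply hne
    have h' := sub_eq_zero.1 h
    split_ifs at h' with h1 h2 h2
    · omega
    · have := X_injective h'
      omega
    · have := X_injective h'
      subst h2; subst this; rfl
    · have := X_injective h'
      omega
  · rintro ⟨i, j⟩ hij
    simp only [mem_sigma, mem_univ, true_and, mem_Ioi] at hij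
    rw [dvd_iff_ident]
    have h1 : ident i j (rename (Equiv.swap i j) B) = ident i j B := by
      simp only [ident, aeval_rename]
      congr 2
      funext k
      by_cases hk : k = i
      · subst hk; simp
      · by_cases hk' : k = j
        · subst hk'; simp
        · simp [Equiv.swap_apply_of_ne_of_ne hk hk', hk']
    rw [hB i j hij.ne, map_neg] at h1
    exact self_eq_neg.1 h1.symm

/-- The numerator of `schurTerm` at the identity, over the common denominator `vand N`. -/
noncomputable def numer (u : ℕ → Polynomial ℚ) (lam : StrictPartition) (N : ℕ) :
    MvPolynomial (Fin N) ℚ :=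
  (∏ i ∈ univ.filter (fun i : Fin N => (i : ℕ) < lam.length),
      Polynomial.aeval (X i : MvPolynomial (Fin N) ℚ) (u (lam.part i))) *
    ∏ i : Fin N, ∏ j ∈ Ioi i, if (i : ℕ) < lam.length then X i + X j else X i - X j

theorem rename_vand (ω : Equiv.Perm (Fin N)) :
    rename ω (vand N) = ((Equiv.Perm.sign ω : ℤ) : MvPolynomial (Fin N) ℚ) * vand N := by
  have := ω.prod_Ioi_comp_eq_sign_mul_prod
    (f := fun i j : Fin N => (X i - X j : MvPolynomial (Fin N) ℚ)) (fun i j => by ring)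
  simpa [vand, map_prod] using this

theorem schurTerm_mul_vand (u : ℕ → Polynomial ℚ) (lam : StrictPartition)
    (ω : Equiv.Perm (Fin N)) :
    schurTerm u lam N ω * algebraMap _ (RatFun N) (rename ω (vand N)) =
      algebraMap _ (RatFun N) (rename ω (numer u lam N)) := by
  have hx : ∀ k : Fin N, algebraMap (MvPolynomial (Fin N) ℚ) (RatFun N) (X k) = ratVar k :=
    fun _ => rfl
  have hne : ∀ k l : Fin N, k ≠ l → ratVar k - ratVar l ≠ 0 := by
    intro k l hkl h
    rw [sub_eq_zero] at h
    exact hkl (X_injective (IsFractionRing.injective (MvPolynomial (Fin N) ℚ) (RatFun N) h))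
  have hu : ∀ (k : Fin N) (q : Polynomial ℚ),
      algebraMap (MvPolynomial (Fin N) ℚ) (RatFun N) (rename ω (Polynomial.aeval (X k) q)) =
        Polynomial.aeval (ratVar (ω k)) q := by
    intro k q
    rw [← Polynomial.aeval_algHom_apply, rename_X, ← Polynomial.aeval_algebraMap_apply]
    rfl
  unfold schurTerm numer vand
  simp only [map_mul, map_prod, hu, map_sub, rename_X, hx]
  rw [mul_assoc]
  congr 1
  rw [Finset.prod_filter, ← Finset.prod_mul_distrib]
  refine Finset.prod_congr rfl fun i _ => ?_
  by_cases hi : (i : ℕ) < lam.length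
  · simp only [hi, if_true]
    rw [← Finset.prod_mul_distrib]
    refine Finset.prod_congr rfl fun j hj => ?_
    rw [div_mul_cancel₀ _ (hne _ _ (ω.injective.ne (mem_Ioi.1 hj).ne))]
    simp [hx]
  · simp [hi, hx]

theorem exists_schurPoly (u : ℕ → Polynomial ℚ) (lam : StrictPartition) (N : ℕ) :
    ∃ f : MvPolynomial (Fin N) ℚ, algebraMap _ (RatFun N) f = schurRat u lam N := by
  unfold schurRat
  split_ifs with hl
  swap
  · exact ⟨0, map_zero _⟩
  set B : MvPolynomial (Fin N) ℚ := ∑ ω : Equiv.Perm (Fin N),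
    ((Equiv.Perm.sign ω : ℤ) : MvPolynomial (Fin N) ℚ) * rename ω (numer u lam N) with hBdef
  have hB : ∀ i j : Fin N, i ≠ j → rename (Equiv.swap i j) B = -B := by
    intro i j hij
    rw [hBdef, map_sum, ← Finset.sum_neg_distrib]
    refine Fintype.sum_equiv (Equiv.mulLeft (Equiv.swap i j)) _ _ fun ω => ?_
    simp only [Equiv.coe_mulLeft, map_mul, map_intCast, rename_rename, Equiv.Perm.sign_mul,
      Equiv.Perm.sign_swap hij, Equiv.Perm.coe_mul]
    simp
  obtain ⟨q, hq⟩ := vand_dvd hB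
  have hV : algebraMap (MvPolynomial (Fin N) ℚ) (RatFun N) (vand N) ≠ 0 := fun h =>
    vand_ne_zero (IsFractionRing.injective (MvPolynomial (Fin N) ℚ) (RatFun N)
      (h.trans (map_zero _).symm))
  have hsum : ∑ ω : Equiv.Perm (Fin N), schurTerm u lam N ω = algebraMap _ (RatFun N) q := by
    refine mul_right_cancel₀ hV ?_
    rw [← map_mul, mul_comm q, ← hq, hBdef, Finset.sum_mul, map_sum]
    refine Finset.sum_congr rfl fun ω _ => ?_
    rw [map_mul, ← schurTerm_mul_vand, rename_vand, map_mul, map_intCast]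
    have hs : (((Equiv.Perm.sign ω : ℤ) : RatFun N)) * ((Equiv.Perm.sign ω : ℤ) : RatFun N) = 1 := by
      rw [← Int.cast_mul, ← Units.val_mul, Int.units_mul_self]; simp
    linear_combination (-(schurTerm u lam N ω) * algebraMap _ (RatFun N) (vand N)) * hs
  refine ⟨C (1 / ((N - lam.length).factorial : ℚ)) * q, ?_⟩
  rw [hsum, map_mul]
  congr 1
  rw [← MvPolynomial.algebraMap_eq, ← IsScalarTower.algebraMap_apply]
  simp

end Polynomiality

/-- The polynomials in `N = 0, 1, 2, …` variables given by the rational expressions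
`schurRat u λ N`. -/
noncomputable def schurSeq (u : ℕ → Polynomial ℚ) (lam : StrictPartition) : PolySeq :=
  fun N => (exists_schurPoly u lam N).choose

/-- The defining equation of `schurSeq`, which determines it. -/
theorem algebraMap_schurSeq (u : ℕ → Polynomial ℚ) (lam : StrictPartition) (N : ℕ) :
    algebraMap _ (RatFun N) (schurSeq u lam N) = schurRat u lam N :=
  (exists_schurPoly u lam N).choose_spec

/-- The Schur `P`-function `P_λ`. -/
noncomputable def schurP (lam : StrictPartition) : PolySeq :=
  schurSeq (fun k => Polynomial.X ^ k) lam

/-- The factorial Schur `P`-function `P*_λ`, in which the powers `x^k` are replaced by the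
descending powers `x (x - 1) ⋯ (x - k + 1)`. -/
noncomputable def factorialSchurP (lam : StrictPartition) : PolySeq :=
  schurSeq (fun k => descPochhammer ℚ k) lam

/-- `Ψ` sends `P_λ` to `P*_λ` for every strict partition `λ` (all `P_λ` being elements of `Γ`). -/
def SendsPToFactorialP (Psi : Gam ≃ₗ[ℚ] Gam) : Prop :=
  ∀ lam : StrictPartition, ∃ h : schurP lam ∈ Gam,
    ((Psi ⟨schurP lam, h⟩ : Gam) : PolySeq) = factorialSchurP lam

end ShiftedPlancherel

open ShiftedPlancherel

namespace ShiftedPlancherel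

/-! The algebra Γ is a polynomial ring in p_1, p_3, p_5, …, modelled by `OddPower`. On it D = ∂/∂p_1
and multiplication by p_1 satisfy [D, p_1^j] = j p_1^(j-1). In the basis of Schur P-functions,
multiplication by p_1 adds a box in all possible ways (`X_zero_mul_powP_parts`), while D removes a
box with weight 2, or 1 if a row disappears (`pderiv_powP_parts`). Comparing coefficients in the
commutation relation gives an identity for the numbers g^{λ/ν} (`sum_upperCovers_gSkew`).

The second ingredient is the formula P*_ν(λ) g^λ/|λ|! = g^{λ/ν}/(|λ|-|ν|)!, for |λ| ≥ |ν|. Here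
g^λ/|λ|! is the product H(λ) = `hookWeight`, and multiplying by it turns the value of P*_ν into the
alternating sum `factorialValue` (`rowSum_mul_hookWeight`). This sum satisfies the same recursion
under removal of a box as the right-hand side (`stepSum_factorialValue`, `gSkew_eq_factorialValue`).

Together they give `oneStep_evalPart`: the one-box average of Ψ(f) at μ is Ψ(f)(μ) + Ψ(Df)(μ). The
measure P_{μ,n} is the law after n such steps (`average_succ`). Hence Df = 0 implies that Ψ(f) keeps
its value at μ on average; p_ρ without parts 1 is such an f, and f = 1 gives total mass 1.

For Ψ itself, the P*_ν are linearly independent even as functions on strict partitions, because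
their values form a triangular array. They span because Euler's theorem (odd versus distinct parts)
bounds the dimensions of the weight filtration (`weightLT_eq_span`). The map P*_λ ↦ P_λ is the
identity up to lower weight, hence bijective, and Ψ is its inverse. Independence on strict
partitions also shows that p_1, p_3, … are algebraically independent (`toSeq_injective`). -/

/-! ### Sums over the entries of a list -/

section Pick

variable {α M : Type*}

/-- The sum of `f x rest` over the entries `x` of a list, `rest` being the list of the other
entries. -/
def pick [AddCommMonoid M] : (α → List α → M) → List α → M
  | _, [] => 0
  | f, x :: xs => f x xs + pick (fun y ys => f y (x :: ys)) xs

/-- The alternating variant of `pick`: the entry in position `i` gets the sign `(-1) ^ i`. -/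
def altPick [AddCommGroup M] : (α → List α → M) → List α → M
  | _, [] => 0
  | f, x :: xs => f x xs - altPick (fun y ys => f y (x :: ys)) xs

/-- The sum of the values of `F` at the lists that arise by applying `s` to one entry. -/
def stepSum [AddCommMonoid M] (s : ℕ → ℕ) : (List ℕ → M) → List ℕ → M
  | _, [] => 0
  | F, x :: xs => F (s x :: xs) + stepSum s (fun ys => F (x :: ys)) xs

section Monoid

variable [AddCommMonoid M]

theorem pick_congr {f g : α → List α → M} {xs : List α}
    (h : ∀ y ys, (y :: ys).Perm xs → f y ys = g y ys) : pick f xs = pick g xs := by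
  induction xs generalizing f g with
  | nil => rfl
  | cons x xs ih =>
    simp only [pick]
    rw [h x xs (List.Perm.refl _), ih]
    intro y ys hy
    exact h y (x :: ys) ((List.Perm.swap x y ys).trans (hy.cons x))

theorem pick_zero (xs : List α) : pick (fun _ _ => (0 : M)) xs = 0 := by
  induction xs with
  | nil => rfl
  | cons x xs ih => simp [pick, ih]

theorem pick_add (f g : α → List α → M) (xs : List α) :
    pick (fun y ys => f y ys + g y ys) xs = pick f xs + pick g xs := by
  induction xs generalizing f g with
  | nil => simp [pick]
  | cons x xs ih => simp only [pick, ih]; abel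

theorem pick_map_hom {M' : Type*} [AddCommMonoid M'] (φ : M →+ M') (f : α → List α → M)
    (xs : List α) : pick (fun y ys => φ (f y ys)) xs = φ (pick f xs) := by
  induction xs generalizing f with
  | nil => simp [pick]
  | cons x xs ih => simp only [pick, map_add, ih]

/-- The double sum runs over ordered pairs of positions, and the pairs (i, j) and (j, i) cancel. -/
theorem pick_eq_zero_of_antisymm {M : Type*} [AddCommGroup M] {f : α → α → List α → M}
    (hf : ∀ y z zs, f y z zs = -f z y zs) (xs : List α) :
    pick (fun y ys => pick (f y) ys) xs = 0 := by
  induction xs generalizing f with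
  | nil => rfl
  | cons x xs ih =>
    simp only [pick]
    rw [pick_add, ih (f := fun y z zs => f y z (x :: zs)) (fun y z zs => hf y z _), add_zero,
      ← pick_add, ← pick_zero (M := M) xs]
    refine pick_congr fun y ys _ => ?_
    rw [hf x y ys]
    simp

theorem pick_ofFn {N : ℕ} (f : α → List α → M) (x : Fin (N + 1) → α) :
    pick f (List.ofFn x) = ∑ i, f (x i) (List.ofFn fun j => x (i.succAbove j)) := by
  induction N generalizing f with
  | zero => simp [pick]
  | succ N ih =>
    rw [List.ofFn_succ, pick, Fin.sum_univ_succ, ih]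
    congr 1
    refine Finset.sum_congr rfl fun i _ => ?_
    rw [List.ofFn_succ]
    simp

theorem stepSum_map_hom {M' : Type*} [AddCommMonoid M'] (φ : M →+ M') (s : ℕ → ℕ)
    (F : List ℕ → M) (xs : List ℕ) :
    stepSum s (fun ys => φ (F ys)) xs = φ (stepSum s F xs) := by
  induction xs generalizing F with
  | nil => simp [stepSum]
  | cons x xs ih => simp only [stepSum, map_add, ih]

theorem stepSum_eq_sum (s : ℕ → ℕ) (F : List ℕ → M) (xs : List ℕ) :
    stepSum s F xs = ∑ i ∈ range xs.length, F (xs.modify i s) := by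
  induction xs generalizing F with
  | nil => simp [stepSum]
  | cons x xs ih =>
    rw [stepSum, List.length_cons, Finset.sum_range_succ', ih, add_comm]
    simp

end Monoid

section Ring

variable {K : Type*} [CommRing K]

theorem pick_mul_left (c : K) (f : α → List α → K) (xs : List α) :
    pick (fun y ys => c * f y ys) xs = c * pick f xs :=
  pick_map_hom (AddMonoidHom.mulLeft c) f xs

theorem pick_mul_right (c : K) (f : α → List α → K) (xs : List α) :
    pick (fun y ys => f y ys * c) xs = pick f xs * c :=
  pick_map_hom (AddMonoidHom.mulRight c) f xs

theorem stepSum_mul_left (c : K) (s : ℕ → ℕ) (F : List ℕ → K) (xs : List ℕ) :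
    stepSum s (fun ys => c * F ys) xs = c * stepSum s F xs :=
  stepSum_map_hom (AddMonoidHom.mulLeft c) s F xs

theorem altPick_congr {M : Type*} [AddCommGroup M] {f g : α → List α → M} {xs : List α}
    (h : ∀ y ys, (y :: ys).Perm xs → f y ys = g y ys) : altPick f xs = altPick g xs := by
  induction xs generalizing f g with
  | nil => rfl
  | cons x xs ih =>
    simp only [altPick]
    rw [h x xs (List.Perm.refl _), ih]
    intro y ys hy
    exact h y (x :: ys) ((List.Perm.swap x y ys).trans (hy.cons x))

theorem altPick_add {M : Type*} [AddCommGroup M] (f g : α → List α → M) (xs : List α) :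
    altPick (fun y ys => f y ys + g y ys) xs = altPick f xs + altPick g xs := by
  induction xs generalizing f g with
  | nil => simp [altPick]
  | cons x xs ih => simp only [altPick, ih]; abel

theorem altPick_mul_left (c : K) (f : α → List α → K) (xs : List α) :
    altPick (fun y ys => c * f y ys) xs = c * altPick f xs := by
  induction xs generalizing f with
  | nil => simp [altPick]
  | cons x xs ih => simp only [altPick, ih]; ring

end Ring

end Pick

/-! ### Partial fractions -/

section PartialFractions

universe u

variable {ι : Type*} {K : Type u} [Field K]

/-- The product of `(a y - b z) / (a y - a z)` over the entries `z` of a list. -/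
def residue (a b : ι → K) (y : ι) (ys : List ι) : K :=
  (ys.map fun z => (a y - b z) / (a y - a z)).prod

theorem residue_cons (a b : ι → K) (y z : ι) (ys : List ι) :
    residue a b y (z :: ys) = (a y - b z) / (a y - a z) * residue a b y ys := by
  simp [residue]

/-- Think of `E x` as 1/(s - a x): the hypothesis `hE` is the resolvent identity, the only property
of these functions that the expansion needs. The algebra `A` stays free because the induction uses
its hypothesis twice, once in `A` and once in `K` with s specialised to the new pole. -/
theorem prod_eq_partialFractions (a b : ι → K) (xs : List ι)
    (hxs : xs.Pairwise fun x y => a x ≠ a y)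
    (A : Type u) [CommRing A] [Algebra K A] (E : ι → A)
    (hE : ∀ x ∈ xs, ∀ y ∈ xs, a x ≠ a y → (a x - a y) • (E x * E y) = E x - E y) :
    (xs.map fun x => 1 + (a x - b x) • E x).prod =
      1 + pick (fun y ys => ((a y - b y) * residue a b y ys) • E y) xs := by
  induction xs generalizing A with
  | nil => simp [pick]
  | cons y xs ih =>
    obtain ⟨hy, hxs⟩ := List.pairwise_cons.1 hxs
    -- At s = a y the product over `xs` becomes the residue at `y`.
    have hnum := ih hxs K (fun x => 1 / (a y - a x)) (by
      intro x hx x' hx' hne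
      have h1 := sub_ne_zero.2 (hy x hx)
      have h2 := sub_ne_zero.2 (hy x' hx')
      simp only [smul_eq_mul]
      field_simp
      ring)
    have hres : residue a b y xs =
        1 + pick (fun x ys => ((a x - b x) * residue a b x ys) • (1 / (a y - a x))) xs := by
      rw [← hnum, residue]
      congr 1
      refine List.map_congr_left fun x hx => ?_
      have h1 := sub_ne_zero.2 (hy x hx)
      simp only [smul_eq_mul]
      field_simp
      ring
    rw [List.map_cons, List.prod_cons, ih hxs A E
      (fun x hx x' hx' => hE x (by simp [hx]) x' (by simp [hx'])), pick, hres]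
    -- The resolvent identity splits `E y * E x`: the `E x` part completes the residue at `x` by its
    -- factor from `y`, and the `E y` parts add up to the residue at `y`.
    have key : ∀ x ys, (x :: ys).Perm xs →
        ((a x - b x) * residue a b x (y :: ys)) • E x =
          ((a x - b x) * residue a b x ys) • E x +
          ((a y - b y) • E y) * (((a x - b x) * residue a b x ys) • E x) +
          (-(a y - b y) * (((a x - b x) * residue a b x ys) • (1 / (a y - a x)))) • E y := by
      intro x ys hx
      have hxm : x ∈ xs := hx.subset (by simp)
      have h1 := sub_ne_zero.2 (hy x hxm)
      have h1' : a x - a y ≠ 0 := sub_ne_zero.2 (hy x hxm).symm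
      have hXY : E y * E x = (1 / (a x - a y)) • (E x - E y) := by
        rw [← hE x (by simp [hxm]) y (by simp) (hy x hxm).symm, smul_smul,
          one_div_mul_cancel h1', one_smul, mul_comm]
      rw [smul_mul_smul_comm, hXY, residue_cons, smul_smul, smul_sub, add_assoc, sub_add]
      rw [← sub_smul, add_sub_assoc', ← add_smul]
      have e1 : (a y - b y) * ((a x - b x) * residue a b x ys) * (1 / (a x - a y)) -
          -(a y - b y) * ((a x - b x) * residue a b x ys) • (1 / (a y - a x)) = 0 := by
        simp only [smul_eq_mul]
        have : 1 / (a y - a x) = - (1 / (a x - a y)) := by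
          rw [← neg_sub (a x) (a y), one_div, one_div, inv_neg]
        rw [this]; ring
      rw [e1, zero_smul, sub_zero]
      congr 1
      field_simp
      ring
    rw [pick_congr key, pick_add, pick_add, pick_mul_left]
    have e2 := pick_map_hom (((LinearMap.toSpanSingleton K A (E y)).toAddMonoidHom).comp
      (AddMonoidHom.mulLeft (-(a y - b y))))
      (fun x ys => ((a x - b x) * residue a b x ys) • (1 / (a y - a x))) xs
    simp only [AddMonoidHom.coe_comp, Function.comp_apply, AddMonoidHom.coe_mulLeft,
      LinearMap.toAddMonoidHom_coe, LinearMap.toSpanSingleton_apply] at e2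
    rw [e2]
    generalize pick (fun y ys => ((a y - b y) * residue a b y ys) • E y) xs = P
    generalize pick (fun x ys => ((a x - b x) * residue a b x ys) • (1 / (a y - a x))) xs = Q
    simp only [Algebra.smul_def, map_mul, map_add, map_neg, map_one]
    ring

open PowerSeries in
-- The case E = X/(1 - aX), that is 1/(s - a) with s = 1/X.
theorem prod_eq_partialFractions_powerSeries (a b : ι → K) (xs : List ι)
    (hxs : xs.Pairwise fun x y => a x ≠ a y) :
    (xs.map fun x => 1 + (a x - b x) • (X * PowerSeries.mk fun n => a x ^ n : K⟦X⟧)).prod =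
      1 + pick (fun y ys => ((a y - b y) * residue a b y ys) • (X * PowerSeries.mk fun n => a y ^ n : K⟦X⟧))
        xs := by
  refine prod_eq_partialFractions a b xs hxs _ _ fun x _ y _ hne => ?_
  have hg : ∀ r : K, (1 - C r * X : K⟦X⟧) * PowerSeries.mk (fun n => r ^ n) = 1 := fun r => by
    ext n
    rcases n with _ | n
    · simp
    · simp [sub_mul, mul_assoc, coeff_succ_X_mul, coeff_one, pow_succ']
  set U : K⟦X⟧ := PowerSeries.mk fun n => a x ^ n
  set V : K⟦X⟧ := PowerSeries.mk fun n => a y ^ n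
  rw [smul_eq_C_mul, map_sub]
  linear_combination (X * U) * hg (a y) - (X * V) * hg (a x)

end PartialFractions


/-! ### The abstract algebra of odd power sums -/

/-- The polynomial ring in which the variable with index `m` stands for `p_{2m+1}`. -/
abbrev OddPower : Type := MvPolynomial ℕ ℚ

section Evaluation

variable {K : Type*} [Field K]

/-- The product of `(y + z) / (y - z)` over the entries `z` of a list. -/
def ratio (y : K) (ys : List K) : K := (ys.map fun z => (y + z) / (y - z)).prod

theorem ratio_cons (y z : K) (ys : List K) :
    ratio y (z :: ys) = (y + z) / (y - z) * ratio y ys := by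
  simp [ratio]

theorem ratio_perm (y : K) {ys zs : List K} (h : ys.Perm zs) : ratio y ys = ratio y zs :=
  (h.map _).prod_eq

theorem residue_neg (y : K) (ys : List K) : residue (fun z => z) (fun z => -z) y ys = ratio y ys := by
  simp [residue, ratio]

/-- Evaluation of an element of `OddPower` at the entries of a list. -/
noncomputable def evalList [Algebra ℚ K] (xs : List K) : OddPower →ₐ[ℚ] K :=
  MvPolynomial.aeval fun m => (xs.map fun x => x ^ (2 * m + 1)).sum

theorem evalList_X [Algebra ℚ K] (xs : List K) (m : ℕ) :
    evalList xs (MvPolynomial.X m) = (xs.map fun x => x ^ (2 * m + 1)).sum := by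
  simp [evalList]

/-- The one-row Schur `P`-function `P_{(a)}` as a polynomial in the odd power sums, given by its
Newton identity; the index `0` gets the value `1 / 2`. -/
noncomputable def rowP : ℕ → OddPower
  | 0 => MvPolynomial.C (1 / 2)
  | a + 1 => MvPolynomial.C (2 / ((a : ℚ) + 1)) *
      ∑ m : Fin (a / 2 + 1), MvPolynomial.X (m : ℕ) * rowP (a - 2 * m)

theorem rowP_zero : rowP 0 = MvPolynomial.C (1 / 2) := by rw [rowP]

theorem newton_rowP (a : ℕ) : ((a : OddPower) + 1) * rowP (a + 1) =
    2 * ∑ m ∈ range (a / 2 + 1), MvPolynomial.X m * rowP (a - 2 * m) := by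
  rw [rowP, Finset.sum_range fun m => (MvPolynomial.X m * rowP (a - 2 * m) : OddPower), ← mul_assoc]
  congr 1
  have h : ((a : OddPower) + 1) = MvPolynomial.C ((a : ℚ) + 1) := by simp
  have h2 : (2 : OddPower) = MvPolynomial.C 2 := (map_ofNat MvPolynomial.C 2).symm
  rw [h, h2, ← map_mul]
  congr 1
  have : (a : ℚ) + 1 ≠ 0 := by positivity
  field_simp

open PowerSeries in
-- The series is (1 + xX)/(1 - xX), whose logarithmic derivative contains x to odd powers only; all
-- identities are checked after clearing denominators.
theorem X_mul_derivative_geometric (x : K) :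
    (X : K⟦X⟧) * d⁄dX K (1 + (x - -x) • (X * PowerSeries.mk fun n => x ^ n)) =
      (1 + (x - -x) • (X * PowerSeries.mk fun n => x ^ n)) *
        (2 * PowerSeries.mk fun n => if Odd n then x ^ n else 0) := by
  set g : K⟦X⟧ := PowerSeries.mk fun n => x ^ n with hg
  set O : K⟦X⟧ := PowerSeries.mk fun n => if Odd n then x ^ n else 0 with hO
  have h1 : (1 - C x * X) * g = 1 := by
    ext n
    rcases n with _ | n
    · simp [hg]
    · simp [hg, sub_mul, mul_assoc, coeff_succ_X_mul, coeff_one, pow_succ']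
  have h2 : (1 - C x * X) * (1 + C x * X) * O = C x * X := by
    have e : (1 - C x * X) * (1 + C x * X) * O = O - C (x ^ 2) * (X * (X * O)) := by
      simp only [map_pow]; ring
    rw [e]
    ext n
    rcases n with _ | _ | n
    · simp [hO]
    · simp only [hO, map_sub, coeff_C_mul, coeff_succ_X_mul, coeff_mk, coeff_zero_X_mul]
      simp
    · have hn : Odd (n + 1 + 1) ↔ Odd n := by
        rw [add_assoc]; simp [Nat.odd_add]
      have hx : (coeff (n + 1 + 1)) (C x * X : K⟦X⟧) = 0 := by
        rw [coeff_C_mul, coeff_X]; simp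
      rw [hx]
      simp only [hO, map_sub, coeff_C_mul, coeff_succ_X_mul, coeff_mk, hn]
      split_ifs <;> ring
  set G : K⟦X⟧ := 1 + (x - -x) • (X * g) with hG
  have h3 : G * (1 - C x * X) = 1 + C x * X := by
    have : G = 1 + 2 * C x * (X * g) := by
      rw [hG, smul_eq_C_mul]; simp only [map_sub, map_neg]; ring
    rw [this]
    linear_combination (2 * C x * X) * h1
  clear_value G
  have h4 := congrArg (d⁄dX K) h3
  have h5 : d⁄dX K (C x * X : K⟦X⟧) = C x := by
    rw [← smul_eq_C_mul, Derivation.map_smul, derivative_X, smul_eq_C_mul, mul_one]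
  have h6 : d⁄dX K (1 + C x * X : K⟦X⟧) = C x := by
    rw [map_add, h5, Derivation.map_one_eq_zero, zero_add]
  have h7 : d⁄dX K (1 - C x * X : K⟦X⟧) = -C x := by
    rw [map_sub, h5, Derivation.map_one_eq_zero, zero_sub]
  rw [Derivation.leibniz, h6, h7, smul_eq_mul, smul_eq_mul] at h4
  have hne : (1 - C x * X : K⟦X⟧) ≠ 0 := fun h => by
    have := congrArg constantCoeff h
    simp at this
  refine mul_left_cancel₀ (mul_ne_zero hne hne) ?_
  linear_combination ((1 - C x * X) * X) * h4 + (C x * X - 2 * O * (1 - C x * X)) * h3 - 2 * h2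

open PowerSeries in
theorem X_mul_derivative_prod (xs : List K) :
    (X : K⟦X⟧) * d⁄dX K
        (xs.map fun x => 1 + (x - -x) • (X * PowerSeries.mk fun n => x ^ n : K⟦X⟧)).prod =
      (xs.map fun x => 1 + (x - -x) • (X * PowerSeries.mk fun n => x ^ n : K⟦X⟧)).prod *
        (2 * PowerSeries.mk fun n => if Odd n then (xs.map fun x => x ^ n).sum else 0) := by
  induction xs with
  | nil =>
    have : (PowerSeries.mk fun n => if Odd n then (([] : List K).map fun x => x ^ n).sum else 0) =
        0 := by
      ext n; simp
    rw [this]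
    simp
  | cons x xs ih =>
    have : (PowerSeries.mk fun n => if Odd n then ((x :: xs).map fun x => x ^ n).sum else 0) =
        (PowerSeries.mk fun n => if Odd n then x ^ n else 0) +
          PowerSeries.mk fun n => if Odd n then (xs.map fun x => x ^ n).sum else 0 := by
      ext n
      simp only [coeff_mk, map_add, List.map_cons, List.sum_cons]
      split_ifs <;> simp
    rw [this, List.map_cons, List.prod_cons, Derivation.leibniz, smul_eq_mul, smul_eq_mul]
    have h := X_mul_derivative_geometric x
    generalize (1 + (x - -x) • (X * PowerSeries.mk fun n => x ^ n) : K⟦X⟧) = G at *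
    generalize (xs.map fun x => 1 + (x - -x) • (X * PowerSeries.mk fun n => x ^ n : K⟦X⟧)).prod = Q
      at *
    linear_combination G * ih + Q * h

open PowerSeries in
-- The product of the (1 + xX)/(1 - xX) is the generating function of the 2P_(a). Its logarithmic
-- derivative is the Newton recursion that defines `rowP`, and its constant term 1 explains the
-- value 1/2 of `rowP 0`.
theorem two_mul_evalList_rowP [CharZero K] [Algebra ℚ K] (xs : List K) (a : ℕ) :
    2 * evalList xs (rowP a) = coeff a
      (xs.map fun x => 1 + (x - -x) • (X * PowerSeries.mk fun n => x ^ n : K⟦X⟧)).prod := by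
  induction a using Nat.strong_induction_on with
  | _ a ih =>
  rcases a with _ | a
  · rw [rowP_zero, ← MvPolynomial.algebraMap_eq, AlgHom.commutes, coeff_zero_eq_constantCoeff_apply,
      map_list_prod, List.map_map, List.prod_eq_one]
    · simp
    · simp
  · have h := congrArg (coeff (a + 1)) (X_mul_derivative_prod xs)
    set Q := (xs.map fun x => 1 + (x - -x) • (X * PowerSeries.mk fun n => x ^ n : K⟦X⟧)).prod
    rw [coeff_succ_X_mul, coeff_derivative, mul_comm Q, mul_assoc, ← map_ofNat (C (R := K)) 2,
      coeff_C_mul, coeff_mul,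
      Finset.Nat.sum_antidiagonal_eq_sum_range_succ (fun i j => (coeff i)
        (PowerSeries.mk fun n => if Odd n then (xs.map fun x => x ^ n).sum else 0) * coeff j Q)] at h
    -- Only the odd indices k = 2m + 1 contribute to the convolution.
    have hs : ∑ m ∈ range (a / 2 + 1), (xs.map fun x => x ^ (2 * m + 1)).sum * coeff (a - 2 * m) Q =
        ∑ k ∈ range (a + 1).succ, (coeff k)
          (PowerSeries.mk fun n => if Odd n then (xs.map fun x => x ^ n).sum else 0) *
            coeff (a + 1 - k) Q := by
      refine Finset.sum_of_injOn (fun m => 2 * m + 1) ?_ ?_ ?_ ?_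
      · intro m _ m' _ h
        simpa using h
      · intro m hm
        simp only [coe_range, Set.mem_Iio] at hm ⊢
        omega
      · intro k hk hk'
        rw [coeff_mk, if_neg, zero_mul]
        rintro ⟨m, rfl⟩
        refine hk' ⟨m, ?_, rfl⟩
        simp only [coe_range, Set.mem_Iio, mem_range, Nat.succ_eq_add_one] at hk ⊢
        omega
      · intro m hm
        rw [coeff_mk, if_pos ⟨m, rfl⟩, show a + 1 - (2 * m + 1) = a - 2 * m by omega]
    rw [← hs] at h
    have h2 := congrArg (evalList xs) (newton_rowP a)
    simp only [map_mul, map_add, map_natCast, map_one, map_ofNat, map_sum, evalList_X] at h2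
    have ha : (a : K) + 1 ≠ 0 := by exact_mod_cast Nat.succ_ne_zero a
    refine mul_left_cancel₀ ha ?_
    rw [mul_comm _ (coeff _ _), h, mul_left_comm, h2]
    congr 1
    rw [Finset.mul_sum]
    refine Finset.sum_congr rfl fun m _ => ?_
    rw [← ih (a - 2 * m) (by omega)]
    ring

/-- For distinct entries the generating function has simple poles, so its coefficients can be read
off from partial fractions. In positive degree the summand 1 of the expansion plays no role, and the
factor y - (-y) = 2y absorbs the 2. -/
theorem evalList_rowP [CharZero K] [Algebra ℚ K] {xs : List K} (hxs : xs.Nodup) (a : ℕ) :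
    evalList xs (rowP (a + 1)) = pick (fun y ys => y ^ (a + 1) * ratio y ys) xs := by
  have h := two_mul_evalList_rowP xs (a + 1)
  rw [prod_eq_partialFractions_powerSeries (fun x => x) (fun x => -x) xs hxs, map_add,
    PowerSeries.coeff_one, if_neg (Nat.succ_ne_zero a), zero_add] at h
  have e := pick_map_hom (PowerSeries.coeff (R := K) (a + 1)).toAddMonoidHom
    (fun y ys => ((y - -y) * residue (fun x => x) (fun x => -x) y ys) •
      (PowerSeries.X * PowerSeries.mk fun n => y ^ n)) xs
  simp only [LinearMap.toAddMonoidHom_coe, map_smul, PowerSeries.coeff_succ_X_mul,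
    PowerSeries.coeff_mk, smul_eq_mul] at e
  rw [← e] at h
  refine mul_left_cancel₀ (two_ne_zero (α := K)) ?_
  rw [h, ← pick_mul_left]
  refine pick_congr fun y ys _ => ?_
  rw [residue_neg]
  ring

end Evaluation


/-! ### Building up Schur `P`-functions row by row -/

/-- The effect on a function of removing one variable `t`, as a polynomial in `t`. -/
noncomputable def removeVar : OddPower →ₐ[ℚ] Polynomial OddPower :=
  MvPolynomial.aeval fun m =>
    Polynomial.C (MvPolynomial.X m) - Polynomial.X ^ (2 * m + 1)

/-- The linear map that replaces `t ^ j` by `rowP j`. -/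
noncomputable def rowMap : Polynomial OddPower →ₗ[OddPower] OddPower :=
  Polynomial.lsum fun j => (LinearMap.id : OddPower →ₗ[OddPower] OddPower).smulRight (rowP j)

theorem rowMap_monomial (j : ℕ) (c : OddPower) :
    rowMap (Polynomial.monomial j c) = c * rowP j := by
  simp [rowMap, Polynomial.lsum_apply, Polynomial.sum_monomial_index]

theorem rowMap_eq_sum {n : ℕ} {H : Polynomial OddPower} (h : H.natDegree < n) :
    rowMap H = ∑ j ∈ range n, H.coeff j * rowP j := by
  rw [rowMap, Polynomial.lsum_apply, Polynomial.sum_over_range' _ (by simp) n h]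
  simp

/-- The operator that adds a row, with the one-variable polynomial `u`, on top of the diagram. -/
noncomputable def addRow (u : Polynomial ℚ) : OddPower →ₗ[ℚ] OddPower :=
  (rowMap.restrictScalars ℚ).comp
    ((LinearMap.mulLeft ℚ (u.map (algebraMap ℚ OddPower))).comp removeVar.toLinearMap)

theorem addRow_apply (u : Polynomial ℚ) (g : OddPower) :
    addRow u g = rowMap (u.map (algebraMap ℚ OddPower) * removeVar g) := rfl

theorem addRow_sub (u v : Polynomial ℚ) (g : OddPower) :
    addRow (u - v) g = addRow u g - addRow v g := by
  simp [addRow_apply, sub_mul]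

/-- The element of `OddPower` given by the rows `us`. -/
noncomputable def rowProduct (us : List (Polynomial ℚ)) : OddPower :=
  us.foldr (fun u g => addRow u g) 1

theorem rowProduct_cons (u : Polynomial ℚ) (us : List (Polynomial ℚ)) :
    rowProduct (u :: us) = addRow u (rowProduct us) := rfl

section Evaluation

variable {K : Type*} [Field K] [Algebra ℚ K]

/-- The sum over the injections of the rows into the entries of a list that defines Schur
`P`-functions. -/
noncomputable def rowSum : List (Polynomial ℚ) → List K → K
  | [], _ => 1
  | u :: us, xs => pick (fun y ys => Polynomial.aeval y u * ratio y ys * rowSum us ys) xs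

theorem rowSum_eq_zero {us : List (Polynomial ℚ)} {xs : List K} (h : xs.length < us.length) :
    rowSum us xs = 0 := by
  induction us generalizing xs with
  | nil => simp at h
  | cons u us ih =>
    rw [rowSum, ← pick_zero (M := K) xs]
    refine pick_congr fun y ys hy => ?_
    have := hy.length_eq
    simp only [List.length_cons] at this h
    rw [ih (by omega), mul_zero]

/-- With t equal to an entry `y`, the substitution p_r ↦ p_r - t^r leaves the power sums of the
other entries. -/
theorem evalList_removeVar {xs ys : List K} {y : K} (h : (y :: ys).Perm xs) (g : OddPower) :
    (removeVar g).eval₂ (evalList xs : OddPower →+* K) y = evalList ys g := by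
  have : (Polynomial.eval₂RingHom (evalList xs : OddPower →+* K) y).comp
      (removeVar : OddPower →+* Polynomial OddPower) = (evalList ys : OddPower →+* K) := by
    refine MvPolynomial.ringHom_ext' (RingHom.ext_rat _ _) fun m => ?_
    have e := (h.map fun x => x ^ (2 * m + 1)).sum_eq
    simp only [List.map_cons, List.sum_cons] at e
    simp [removeVar, evalList_X, Polynomial.eval₂_sub, ← e]
  exact DFunLike.congr_fun this g

theorem evalList_rowMap [CharZero K] {xs : List K} (hxs : xs.Nodup) (H : Polynomial OddPower) :
    evalList xs (rowMap (Polynomial.X * H)) =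
      pick (fun y ys => y * H.eval₂ (evalList xs : OddPower →+* K) y * ratio y ys) xs := by
  induction H using Polynomial.induction_on' with
  | add p q hp hq =>
    rw [mul_add, map_add, map_add, hp, hq, ← pick_add]
    refine pick_congr fun y ys _ => ?_
    rw [Polynomial.eval₂_add]
    ring
  | monomial n c =>
    rw [Polynomial.X_mul_monomial, rowMap_monomial, map_mul, evalList_rowP hxs, ← pick_mul_left]
    refine pick_congr fun y ys _ => ?_
    rw [Polynomial.eval₂_monomial]
    simp only [RingHom.coe_coe]
    ring

/-- Divisibility of `u` by the variable keeps `rowP 0` out of the computation: its value 1/2 is a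
convention that the sum over the entries does not reproduce. -/
theorem evalList_addRow [CharZero K] {xs : List K} (hxs : xs.Nodup) {u : Polynomial ℚ}
    (hu : Polynomial.X ∣ u) (g : OddPower) :
    evalList xs (addRow u g) =
      pick (fun y ys => Polynomial.aeval y u * ratio y ys * evalList ys g) xs := by
  obtain ⟨v, rfl⟩ := hu
  rw [addRow_apply, Polynomial.map_mul, Polynomial.map_X, mul_assoc, evalList_rowMap hxs]
  refine pick_congr fun y ys hy => ?_
  have e : (v.map (algebraMap ℚ OddPower)).eval₂ (evalList xs : OddPower →+* K) y =
      Polynomial.aeval y v := by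
    rw [Polynomial.eval₂_map, Polynomial.aeval_def]
    congr 1
    exact RingHom.ext fun q => by simp
  rw [Polynomial.eval₂_mul, evalList_removeVar hy, e, map_mul, Polynomial.aeval_X]
  ring

theorem evalList_rowProduct [CharZero K] {us : List (Polynomial ℚ)}
    (hus : ∀ u ∈ us, Polynomial.X ∣ u) {xs : List K} (hxs : xs.Nodup) :
    evalList xs (rowProduct us) = rowSum us xs := by
  induction us generalizing xs with
  | nil => simp [rowProduct, rowSum]
  | cons u us ih =>
    rw [rowProduct_cons, evalList_addRow hxs (hus u (by simp)), rowSum]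
    refine pick_congr fun y ys hy => ?_
    rw [ih (fun v hv => hus v (by simp [hv])) (List.nodup_cons.1 (hy.nodup_iff.2 hxs)).2]

/-- Exchanging the entries chosen by the two equal rows changes only the sign of the factor (y +
z)/(y - z). -/
theorem rowSum_cons_self_cons (u : Polynomial ℚ) (us : List (Polynomial ℚ)) (xs : List K) :
    rowSum (u :: u :: us) xs = 0 := by
  have := pick_eq_zero_of_antisymm (f := fun y z zs => (Polynomial.aeval y u * Polynomial.aeval z u *
    ratio y zs * ratio z zs * rowSum us zs * ((y + z) / (y - z)) : K)) (fun y z zs => by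
      rw [← neg_sub z y, div_neg]; ring) xs
  rw [← this, rowSum]
  refine pick_congr fun y ys _ => ?_
  rw [rowSum, ← pick_mul_left]
  refine pick_congr fun z zs hz => ?_
  rw [← ratio_perm y hz, ratio_cons]
  ring

end Evaluation

/-! ### Multiplication by `p_1` and differentiation with respect to `p_1` -/

/-- Removing t from p_1 leaves p_1 - t. Writing p_1 = (p_1 - t) + t puts the new box either below
the top row or into it. -/
theorem X_zero_mul_addRow (u : Polynomial ℚ) (g : OddPower) :
    MvPolynomial.X 0 * addRow u g =
      addRow u (MvPolynomial.X 0 * g) + addRow (Polynomial.X * u) g := by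
  simp only [addRow_apply]
  rw [← smul_eq_mul, ← map_smul, ← map_add, map_mul, Polynomial.map_mul, Polynomial.map_X,
    Polynomial.smul_eq_C_mul]
  congr 1
  have : removeVar (MvPolynomial.X 0) = Polynomial.C (MvPolynomial.X 0) - Polynomial.X := by
    simp [removeVar]
  rw [this]
  ring

theorem pderiv_rowP_zero : MvPolynomial.pderiv 0 (rowP 0) = 0 := by
  rw [rowP_zero, MvPolynomial.pderiv_C]

/-- The generating function exp(2 ∑ p_r t^r / r), over odd r, is multiplied by 2t under ∂/∂p_1. In
terms of coefficients this is an induction along the Newton recursion. -/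
theorem pderiv_rowP_succ (a : ℕ) : MvPolynomial.pderiv 0 (rowP (a + 1)) = 2 * rowP a := by
  induction a using Nat.strong_induction_on with
  | _ a ih =>
  have h := congrArg (MvPolynomial.pderiv 0) (newton_rowP a)
  have hc : ((a : OddPower) + 1) = MvPolynomial.C ((a : ℚ) + 1) := by
    rw [map_add, map_natCast, map_one]
  have h2 : (2 : OddPower) = MvPolynomial.C 2 := (map_ofNat MvPolynomial.C 2).symm
  have ha : ((a : OddPower) + 1) ≠ 0 := by exact_mod_cast Nat.succ_ne_zero a
  refine mul_left_cancel₀ ha ?_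
  have hl : MvPolynomial.pderiv 0 (((a : OddPower) + 1) * rowP (a + 1)) =
      ((a : OddPower) + 1) * MvPolynomial.pderiv 0 (rowP (a + 1)) := by
    rw [hc, MvPolynomial.pderiv_C_mul]
  have hr : ∀ g : OddPower, MvPolynomial.pderiv 0 (2 * g) = 2 * MvPolynomial.pderiv 0 g := by
    intro g; rw [h2, MvPolynomial.pderiv_C_mul]
  rw [← hl, h, hr, map_sum]
  -- The first summand comes from differentiating p_1 itself. The condition in the second excludes
  -- 2m = a, where the cofactor is the constant `rowP 0`.
  have hm : ∀ m ∈ range (a / 2 + 1), MvPolynomial.pderiv 0 (MvPolynomial.X m * rowP (a - 2 * m)) =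
      (if m = 0 then rowP a else 0) +
        if 2 * m + 1 ≤ a then 2 * (MvPolynomial.X m * rowP (a - 1 - 2 * m)) else 0 := by
    intro m hm
    rw [Derivation.leibniz, smul_eq_mul, smul_eq_mul, add_comm, MvPolynomial.pderiv_X]
    congr 1
    · by_cases h0 : m = 0
      · subst h0; simp
      · rw [Pi.single_eq_of_ne h0]; simp [h0]
    · split_ifs with hle
      · rw [show a - 2 * m = (a - 1 - 2 * m) + 1 by omega, ih _ (by omega)]
        ring
      · rw [mem_range] at hm
        rw [show a - 2 * m = 0 by omega, pderiv_rowP_zero, mul_zero]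
  rw [Finset.sum_congr rfl hm, Finset.sum_add_distrib, Finset.sum_ite_eq' (range (a / 2 + 1)) 0,
    if_pos (by simp)]
  rcases a with _ | b
  · simp
  · have hn := newton_rowP b
    rw [← Finset.sum_filter]
    have hf : (range ((b + 1) / 2 + 1)).filter (fun m => 2 * m + 1 ≤ b + 1) = range (b / 2 + 1) := by
      ext m
      simp only [mem_filter, mem_range]
      omega
    rw [hf, ← Finset.mul_sum]
    simp only [Nat.add_sub_cancel]
    rw [← hn]
    push_cast
    ring

/-- The substitution p_r ↦ p_r - t^r is a translation, so it commutes with ∂/∂p_1. -/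
theorem coeff_removeVar_pderiv (g : OddPower) (j : ℕ) :
    (removeVar (MvPolynomial.pderiv 0 g)).coeff j =
      MvPolynomial.pderiv 0 ((removeVar g).coeff j) := by
  induction g using MvPolynomial.induction_on generalizing j with
  | C a =>
    rw [MvPolynomial.pderiv_C, map_zero, ← MvPolynomial.algebraMap_eq, AlgHom.commutes,
      IsScalarTower.algebraMap_apply ℚ OddPower, MvPolynomial.algebraMap_eq,
      Polynomial.algebraMap_apply, Polynomial.coeff_C]
    split_ifs <;> simp
  | add p q hp hq => simp only [map_add, Polynomial.coeff_add, hp, hq]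
  | mul_X p m ih =>
    have hX : removeVar (MvPolynomial.X m) =
        Polynomial.C (MvPolynomial.X m) - Polynomial.X ^ (2 * m + 1) := by simp [removeVar]
    have hd : removeVar (MvPolynomial.pderiv 0 (MvPolynomial.X m)) =
        Polynomial.C (MvPolynomial.pderiv 0 (MvPolynomial.X m)) := by
      rw [MvPolynomial.pderiv_X]
      by_cases h0 : m = 0
      · subst h0; simp
      · rw [Pi.single_eq_of_ne h0]; simp
    simp only [Derivation.leibniz, map_add, smul_eq_mul, map_mul, hX, hd, sub_mul, mul_sub,
      Polynomial.coeff_add, Polynomial.coeff_sub, Polynomial.coeff_mul_C, Polynomial.coeff_C_mul,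
      Polynomial.coeff_X_pow_mul', Polynomial.coeff_mul_X_pow', map_sub, ih]
    split_ifs <;> simp
    ring

/-- Leibniz rule: differentiating `rowP j` lowers the index by one and kills the constant `rowP 0`,
which on polynomials in t is the effect of `divX`. -/
theorem pderiv_rowMap {H H₁ : Polynomial OddPower}
    (h : ∀ j, H₁.coeff j = MvPolynomial.pderiv 0 (H.coeff j)) :
    MvPolynomial.pderiv 0 (rowMap H) = rowMap H₁ + 2 * rowMap H.divX := by
  set n := H.natDegree + H₁.natDegree + 1 with hn
  have hd : H.divX.natDegree < n := by
    rw [Polynomial.natDegree_divX_eq_natDegree_tsub_one]; omega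
  rw [rowMap_eq_sum (n := n + 1) (H := H) (by omega), rowMap_eq_sum (n := n + 1) (H := H₁) (by omega),
    rowMap_eq_sum hd, map_sum]
  simp only [Derivation.leibniz, smul_eq_mul, Finset.sum_add_distrib, h]
  rw [add_comm]
  congr 1
  · exact Finset.sum_congr rfl fun j _ => mul_comm _ _
  · rw [Finset.sum_range_succ', pderiv_rowP_zero, mul_zero, add_zero, Finset.mul_sum]
    refine Finset.sum_congr rfl fun j _ => ?_
    rw [pderiv_rowP_succ, Polynomial.coeff_divX]
    ring

theorem pderiv_addRow (u : Polynomial ℚ) (g : OddPower) :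
    MvPolynomial.pderiv 0 (addRow (Polynomial.X * u) g) =
      addRow (Polynomial.X * u) (MvPolynomial.pderiv 0 g) + 2 * addRow u g := by
  simp only [addRow_apply]
  rw [pderiv_rowMap (H₁ := (Polynomial.X * u).map (algebraMap ℚ OddPower) *
    removeVar (MvPolynomial.pderiv 0 g))]
  · rw [Polynomial.map_mul, Polynomial.map_X, mul_assoc, mul_assoc]
    congr 3
    ext1 j
    rw [Polynomial.coeff_divX, Polynomial.coeff_X_mul]
  · intro j
    rw [Polynomial.coeff_mul, Polynomial.coeff_mul, map_sum]
    refine Finset.sum_congr rfl fun p _ => ?_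
    rw [coeff_removeVar_pderiv, Polynomial.coeff_map, MvPolynomial.algebraMap_eq,
      MvPolynomial.pderiv_C_mul]

/-- The Schur `P`-function with the row lengths `as`, in any order and possibly zero. -/
noncomputable def powP (as : List ℕ) : OddPower := rowProduct (as.map fun a => Polynomial.X ^ a)

theorem powP_cons (a : ℕ) (as : List ℕ) :
    powP (a :: as) = addRow (Polynomial.X ^ a) (powP as) := rfl

/-- A zero row contributes the constant `rowP 0`. This half is what makes the removal of a whole row
weigh 1 instead of 2. -/
theorem powP_append_zero (as : List ℕ) : powP (as ++ [0]) = (1 / 2 : ℚ) • powP as := by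
  induction as with
  | nil =>
    have : powP [0] = rowMap (Polynomial.monomial 0 1) := by
      simp [powP, rowProduct, addRow_apply]
    rw [List.nil_append, this, rowMap_monomial, rowP_zero, powP, List.map_nil, rowProduct,
      List.foldr_nil, MvPolynomial.smul_eq_C_mul]
    ring
  | cons a as ih => rw [List.cons_append, powP_cons, ih, map_smul, powP_cons]

theorem pderiv_powP {as : List ℕ} (h : ∀ a ∈ as, 0 < a) :
    MvPolynomial.pderiv 0 (powP as) = (2 : ℚ) • stepSum Nat.pred powP as := by
  induction as with
  | nil => simp [powP, rowProduct, stepSum]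
  | cons a as ih =>
    obtain ⟨b, rfl⟩ := Nat.exists_eq_succ_of_ne_zero (h a (by simp)).ne'
    have e : stepSum Nat.pred (fun ys => powP ((b + 1) :: ys)) as =
        addRow (Polynomial.X ^ (b + 1)) (stepSum Nat.pred powP as) :=
      stepSum_map_hom (addRow (Polynomial.X ^ (b + 1))).toAddMonoidHom Nat.pred powP as
    rw [stepSum, Nat.succ_eq_add_one, e, powP_cons, pow_succ', pderiv_addRow,
      ih fun a ha => h a (by simp [ha]), Nat.pred_eq_sub_one, Nat.add_sub_cancel, powP_cons,
      smul_add, map_smul, add_comm]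
    congr 1
    rw [two_smul, two_mul]

theorem X_zero_mul_powP (as : List ℕ) :
    MvPolynomial.X 0 * powP as = stepSum Nat.succ powP as + powP (as ++ [1]) := by
  induction as with
  | nil =>
    have h1 : powP [1] = rowMap (Polynomial.monomial 1 1) := by
      simp [powP, rowProduct, addRow_apply, Polynomial.monomial_one_one_eq_X]
    have h2 := newton_rowP 0
    simp [rowP_zero] at h2
    rw [List.nil_append, h1, rowMap_monomial, h2]
    simp only [stepSum, powP, rowProduct, List.map_nil, List.foldr_nil]
    have h2 : (2 : OddPower) = MvPolynomial.C 2 := (map_ofNat MvPolynomial.C 2).symm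
    have h3 : (MvPolynomial.C 2 * MvPolynomial.C 2⁻¹ : OddPower) = 1 := by
      rw [← map_mul]; norm_num
    rw [h2]
    linear_combination (-MvPolynomial.X 0) * h3
  | cons a as ih =>
    rw [powP_cons, X_zero_mul_addRow, ih, stepSum, List.cons_append, powP_cons, powP_cons,
      ← pow_succ', map_add]
    have := stepSum_map_hom (addRow (Polynomial.X ^ a)).toAddMonoidHom Nat.succ powP as
    simp only [LinearMap.toAddMonoidHom_coe] at this
    rw [← this]
    simp only [powP_cons, Nat.succ_eq_add_one]
    abel


/-! ### Hook weights and values of factorial Schur `P`-functions -/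

/-- The weight `∏ 1 / x_i! ∏_{i<j} (x_i - x_j) / (x_i + x_j)`. -/
def hookWeight : List ℕ → ℚ
  | [] => 1
  | x :: xs => 1 / (x.factorial : ℚ) * (xs.map fun y : ℕ => ((x : ℚ) - y) / (x + y)).prod * hookWeight xs

/-- The coefficient `1 / (x - a)!`, to be read as `0` if `x < a`. -/
def invFactorial (a x : ℕ) : ℚ := if a ≤ x then 1 / ((x - a).factorial : ℚ) else 0

/-- The product of the hook weight with the value of a factorial Schur `P`-function. -/
def factorialValue : List ℕ → List ℕ → ℚ
  | [] => hookWeight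
  | a :: as => altPick fun y ys => invFactorial a y * factorialValue as ys

theorem hookWeight_pos {xs : List ℕ} (hxs : xs.Pairwise (· > ·)) : 0 < hookWeight xs := by
  induction xs with
  | nil => simp [hookWeight]
  | cons x xs ih =>
    obtain ⟨hx, hxs⟩ := List.pairwise_cons.1 hxs
    refine mul_pos (mul_pos (by positivity) (List.prod_pos ?_)) (ih hxs)
    intro r hr
    obtain ⟨y, hy, rfl⟩ := List.mem_map.1 hr
    have h : (y : ℚ) < x := by exact_mod_cast hx y hy
    have h0 : (0 : ℚ) ≤ y := Nat.cast_nonneg y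
    exact div_pos (by linarith) (by linarith)

/-! ### The hook formula by partial fractions -/

/-- The value at `x` of the ratio in the hook formula after lowering `x` by one. -/
def hookRatio (y : ℕ) (ys : List ℕ) : ℚ :=
  residue (fun x : ℕ => (x : ℚ) * (x - 1)) (fun x : ℕ => (x : ℚ) * (x + 1)) y ys

theorem content_injective {x y : ℕ} (hx : 0 < x) (hy : 0 < y) (h : x ≠ y) :
    (x : ℚ) * (x - 1) ≠ (y : ℚ) * (y - 1) := by
  intro e
  have e' : ((x : ℚ) - y) * (x + y - 1) = 0 := by linear_combination e
  have hx' : (1 : ℚ) ≤ x := by exact_mod_cast hx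
  have hy' : (1 : ℚ) ≤ y := by exact_mod_cast hy
  rcases mul_eq_zero.1 e' with h1 | h1
  · exact h (by exact_mod_cast sub_eq_zero.1 h1)
  · linarith

/-- Compare the coefficients of X in the expansion with poles x(x - 1) and numerator roots x(x + 1).
The differences x(x - 1) - x(x + 1) = -2x give -2 times the sum of the entries on one side and -2y
times the residues on the other. -/
theorem pick_hookRatio {xs : List ℕ} (hxs : xs.Nodup) (hpos : ∀ x ∈ xs, 0 < x) :
    pick (fun (y : ℕ) ys => (y : ℚ) * hookRatio y ys) xs = (xs.sum : ℚ) := by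
  have h := prod_eq_partialFractions_powerSeries (fun x : ℕ => (x : ℚ) * (x - 1))
    (fun x : ℕ => (x : ℚ) * (x + 1)) xs
    (hxs.imp_of_mem fun ha hb hab => content_injective (hpos _ ha) (hpos _ hb) hab)
  have hprod : ∀ zs : List ℕ, PowerSeries.coeff 0 (zs.map fun x : ℕ => 1 + ((x : ℚ) * (x - 1) - x * (x + 1)) •
        (PowerSeries.X * PowerSeries.mk fun n => ((x : ℚ) * (x - 1)) ^ n : PowerSeries ℚ)).prod = 1 ∧
      PowerSeries.coeff 1 (zs.map fun x : ℕ => 1 + ((x : ℚ) * (x - 1) - x * (x + 1)) •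
        (PowerSeries.X * PowerSeries.mk fun n => ((x : ℚ) * (x - 1)) ^ n : PowerSeries ℚ)).prod =
        -2 * (zs.sum : ℚ) := by
    intro zs
    induction zs with
    | nil => simp [PowerSeries.coeff_one]
    | cons z zs ih =>
      rw [List.map_cons, List.prod_cons]
      generalize (zs.map fun x : ℕ => 1 + ((x : ℚ) * (x - 1) - x * (x + 1)) •
        (PowerSeries.X * PowerSeries.mk fun n => ((x : ℚ) * (x - 1)) ^ n : PowerSeries ℚ)).prod = Q
        at *
      have hm : (PowerSeries.mk fun n => ((z : ℚ) * (z - 1)) ^ n).constantCoeff = 1 := by simp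
      generalize (PowerSeries.mk fun n => ((z : ℚ) * (z - 1)) ^ n) = R at *
      have h0 : PowerSeries.coeff (R := ℚ) 0 (1 + ((z : ℚ) * (z - 1) - z * (z + 1)) • (PowerSeries.X * R)) = 1 := by
        simp
      have h1 : PowerSeries.coeff (R := ℚ) 1 (1 + ((z : ℚ) * (z - 1) - z * (z + 1)) • (PowerSeries.X * R)) =
          -2 * z := by
        have e := PowerSeries.coeff_succ_X_mul 0 R
        rw [zero_add, PowerSeries.coeff_zero_eq_constantCoeff_apply, hm] at e
        rw [map_add, PowerSeries.coeff_one, if_neg one_ne_zero, PowerSeries.coeff_smul, e]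
        ring
      rw [PowerSeries.coeff_mul, PowerSeries.coeff_mul, Finset.Nat.antidiagonal_zero,
        Finset.sum_singleton, Finset.Nat.sum_antidiagonal_eq_sum_range_succ_mk]
      simp only [Finset.sum_range_succ, Finset.sum_range_zero, Nat.sub_zero, Nat.sub_self, h0, h1,
        ih.1, ih.2, List.sum_cons]
      refine ⟨by norm_num, by push_cast; ring⟩
  have h1 := congrArg (PowerSeries.coeff 1) h
  rw [(hprod xs).2, map_add, PowerSeries.coeff_one, if_neg one_ne_zero, zero_add] at h1
  have e := pick_map_hom (PowerSeries.coeff (R := ℚ) 1).toAddMonoidHom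
    (fun (y : ℕ) ys => (((y : ℚ) * (y - 1) - y * (y + 1)) * residue (fun x : ℕ => (x : ℚ) * (x - 1))
      (fun x : ℕ => (x : ℚ) * (x + 1)) y ys) •
      (PowerSeries.X * PowerSeries.mk fun n => ((y : ℚ) * (y - 1)) ^ n)) xs
  simp only [LinearMap.toAddMonoidHom_coe] at e
  rw [← e] at h1
  refine mul_left_cancel₀ (show (-2 : ℚ) ≠ 0 by norm_num) ?_
  rw [h1, ← pick_mul_left]
  refine pick_congr fun y ys _ => ?_
  have e2 := PowerSeries.coeff_succ_X_mul 0 (PowerSeries.mk fun n => ((y : ℚ) * (y - 1)) ^ n)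
  rw [zero_add, PowerSeries.coeff_mk, pow_zero] at e2
  rw [PowerSeries.coeff_smul, e2, hookRatio]
  ring

/-- Lowering x multiplies (x - y)/(x + y) by (x + y)(x - y - 1)/((x - y)(x + y - 1)). This is
(x(x-1) - y(y+1))/(x(x-1) - y(y-1)), whence the poles and roots in `hookRatio`. -/
theorem hookWeight_pred_cons {x : ℕ} {xs : List ℕ} (hx : 0 < x) (h : ∀ y ∈ xs, x ≠ y ∧ 0 < y) :
    hookWeight (Nat.pred x :: xs) = x * hookRatio x xs * hookWeight (x :: xs) := by
  obtain ⟨n, rfl⟩ := Nat.exists_eq_succ_of_ne_zero hx.ne'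
  have key : (xs.map fun y : ℕ => ((n : ℚ) - y) / (n + y)).prod =
      hookRatio (n + 1) xs * (xs.map fun y : ℕ => (((n + 1 : ℕ) : ℚ) - y) / ((n + 1 : ℕ) + y)).prod := by
    rw [hookRatio, residue, ← List.prod_map_mul]
    congr 1
    refine List.map_congr_left fun y hy => ?_
    obtain ⟨hne, hpos⟩ := h y hy
    have hc := sub_ne_zero.2 (content_injective (Nat.succ_pos n) hpos hne)
    have h0 : (0 : ℚ) < y := by exact_mod_cast hpos
    have hn : (0 : ℚ) ≤ n := Nat.cast_nonneg n
    have h1 : (n : ℚ) + y ≠ 0 := by positivity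
    have h2 : (n : ℚ) + 1 + y ≠ 0 := by positivity
    push_cast at hc ⊢
    field_simp
    ring
  simp only [hookWeight, Nat.succ_eq_add_one, Nat.pred_succ, key, Nat.factorial_succ]
  have h1 : (n.factorial : ℚ) ≠ 0 := by positivity
  have h2 : ((n : ℚ) + 1) ≠ 0 := by positivity
  push_cast
  field_simp

/-- The weight `c` serves the induction: lowering an entry y behind the head x also changes the
factor (x - y)/(x + y) of the head, and this factor is absorbed into `c`. -/
theorem stepSum_weighted_hookWeight (c : ℕ → ℚ) {xs : List ℕ} (hxs : xs.Nodup)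
    (hpos : ∀ x ∈ xs, 0 < x) :
    stepSum Nat.pred (fun ys => (ys.map c).prod * hookWeight ys) xs =
      pick (fun (y : ℕ) ys => (y : ℚ) * hookRatio y ys * c (Nat.pred y) * (ys.map c).prod) xs *
        hookWeight xs := by
  induction xs generalizing c with
  | nil => simp [stepSum, pick]
  | cons x xs ih =>
    obtain ⟨hx, hxs'⟩ := List.nodup_cons.1 hxs
    have hx0 := hpos x (by simp)
    have hxq : (0 : ℚ) < x := by exact_mod_cast hx0
    have hxx : ∀ y ∈ xs, x ≠ y ∧ 0 < y := fun y hy =>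
      ⟨fun e => hx (e ▸ hy), hpos y (by simp [hy])⟩
    rw [stepSum, pick, add_mul, List.map_cons, List.prod_cons, hookWeight_pred_cons hx0 hxx]
    congr 1
    · ring
    have e : (fun ys => ((x :: ys).map c).prod * hookWeight (x :: ys)) = fun ys =>
        (c x * (1 / (x.factorial : ℚ))) *
          ((ys.map fun y : ℕ => c y * (((x : ℚ) - y) / (x + y))).prod * hookWeight ys) := by
      funext ys
      rw [List.map_cons, List.prod_cons, hookWeight, List.prod_map_mul]
      ring
    rw [e, stepSum_mul_left, ih (fun y : ℕ => c y * (((x : ℚ) - y) / (x + y))) hxs'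
      fun y hy => hpos y (by simp [hy]), hookWeight]
    have e2 : ∀ P Q : ℚ, P * (c x * (1 / (x.factorial : ℚ))) = Q *
        (1 / (x.factorial : ℚ) * (xs.map fun y : ℕ => ((x : ℚ) - y) / (x + y)).prod) →
        c x * (1 / (x.factorial : ℚ)) * (P * hookWeight xs) = Q *
        (1 / (x.factorial : ℚ) * (xs.map fun y : ℕ => ((x : ℚ) - y) / (x + y)).prod * hookWeight xs) :=
      fun P Q h => by linear_combination hookWeight xs * h
    refine e2 _ _ ?_
    rw [← pick_mul_right, ← pick_mul_right]
    refine pick_congr fun y ys hy => ?_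
    obtain ⟨hne, hypos⟩ := hxx y (hy.subset (by simp))
    rw [← (hy.map _).prod_eq, List.map_cons, List.prod_cons, List.map_cons, List.prod_cons,
      List.prod_map_mul, hookRatio, hookRatio, residue_cons]
    have hc := sub_ne_zero.2 (content_injective hypos hx0 hne.symm)
    obtain ⟨n, rfl⟩ := Nat.exists_eq_succ_of_ne_zero hypos.ne'
    rw [Nat.pred_succ]
    have hn : (0 : ℚ) ≤ n := Nat.cast_nonneg n
    have key : ((x : ℚ) - n) / (x + n) =
        (((n.succ : ℕ) : ℚ) * ((n.succ : ℕ) - 1) - x * (x + 1)) / (((n.succ : ℕ) : ℚ) * ((n.succ : ℕ) - 1) - x * (x - 1)) *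
          (((x : ℚ) - (n.succ : ℕ)) / (x + (n.succ : ℕ))) := by
      have h1 : (x : ℚ) + n ≠ 0 := by positivity
      have h2 : (x : ℚ) + (n + 1) ≠ 0 := by positivity
      push_cast at hc ⊢
      field_simp
      ring
    rw [key]
    ring

theorem stepSum_hookWeight {xs : List ℕ} (hxs : xs.Nodup) (hpos : ∀ x ∈ xs, 0 < x) :
    stepSum Nat.pred hookWeight xs = (xs.sum : ℚ) * hookWeight xs := by
  have h := stepSum_weighted_hookWeight (fun _ => 1) hxs hpos
  have e : ∀ ys : List ℕ, (ys.map fun _ => (1 : ℚ)).prod = 1 := fun ys => by simp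
  simp only [e, one_mul, mul_one] at h
  rw [pick_hookRatio hxs hpos] at h
  exact h

/-! ### The box-removal recursion for `factorialValue` -/

theorem invFactorial_pred (a : ℕ) {x : ℕ} (hx : 0 < x) :
    invFactorial a (Nat.pred x) = ((x : ℚ) - a) * invFactorial a x := by
  obtain ⟨n, rfl⟩ := Nat.exists_eq_succ_of_ne_zero hx.ne'
  unfold invFactorial
  rw [Nat.pred_succ]
  rcases lt_trichotomy a (n + 1) with h | rfl | h
  · obtain ⟨k, rfl⟩ := Nat.exists_eq_add_of_le (Nat.lt_succ_iff.1 h)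
    rw [if_pos (by omega), if_pos (by omega), show (a + k).succ - a = k + 1 by omega,
      show a + k - a = k by omega, Nat.factorial_succ]
    have h1 : (k.factorial : ℚ) ≠ 0 := by positivity
    have h2 : ((k : ℚ) + 1) ≠ 0 := by positivity
    push_cast
    field_simp
    ring
  · rw [if_neg (by omega)]
    simp
  · rw [if_neg (by omega), if_neg (by omega), mul_zero]

theorem stepSum_altPick (φ : ℕ → ℚ) (F : List ℕ → ℚ) (xs : List ℕ) :
    stepSum Nat.pred (altPick fun y ys => φ y * F ys) xs =
      altPick (fun y ys => φ (Nat.pred y) * F ys) xs +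
        altPick (fun y ys => φ y * stepSum Nat.pred F ys) xs := by
  induction xs generalizing F with
  | nil => simp [stepSum, altPick]
  | cons x xs ih =>
    have hs : ∀ (f g : List ℕ → ℚ) (zs : List ℕ), stepSum Nat.pred (fun ys => f ys - g ys) zs =
        stepSum Nat.pred f zs - stepSum Nat.pred g zs := by
      intro f g zs
      simp [stepSum_eq_sum, Finset.sum_sub_distrib]
    simp only [stepSum, altPick, mul_add]
    rw [hs, stepSum_mul_left, ih, altPick_add]
    ring

/-- Lowering the picked entry y contributes the factor y - a, lowering one of the others contributes
the difference of the remaining sums, and the total is the same for every y. -/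
theorem stepSum_factorialValue (as : List ℕ) {xs : List ℕ} (hxs : xs.Nodup)
    (hpos : ∀ x ∈ xs, 0 < x) :
    stepSum Nat.pred (factorialValue as) xs =
      ((xs.sum : ℚ) - (as.sum : ℚ)) * factorialValue as xs := by
  induction as generalizing xs with
  | nil => simp [factorialValue, stepSum_hookWeight hxs hpos]
  | cons a as ih =>
    rw [factorialValue, stepSum_altPick, ← altPick_add, ← altPick_mul_left]
    refine altPick_congr fun y ys hy => ?_
    have hmem : ∀ z ∈ y :: ys, z ∈ xs := fun z hz => hy.subset hz
    rw [ih (List.nodup_cons.1 (hy.nodup_iff.2 hxs)).2 fun z hz => hpos z (hmem z (by simp [hz])),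
      invFactorial_pred a (hpos y (hmem y (by simp))), ← hy.sum_eq]
    push_cast [List.sum_cons]
    ring

/-! ### Degenerate lists, vanishing and triangularity -/

theorem hookWeight_append_zero {xs : List ℕ} (hpos : ∀ x ∈ xs, 0 < x) :
    hookWeight (xs ++ [0]) = hookWeight xs := by
  induction xs with
  | nil => simp [hookWeight]
  | cons x xs ih =>
    have hx : (x : ℚ) ≠ 0 := by exact_mod_cast (hpos x (by simp)).ne'
    simp [hookWeight, ih fun y hy => hpos y (by simp [hy]), hx]

theorem altPick_append_zero {φ : ℕ → ℚ} (h0 : φ 0 = 0) {F : List ℕ → ℚ} {xs : List ℕ}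
    (hF : ∀ ys : List ℕ, (∀ y ∈ ys, y ∈ xs) → F (ys ++ [0]) = F ys) :
    altPick (fun y ys => φ y * F ys) (xs ++ [0]) = altPick (fun y ys => φ y * F ys) xs := by
  induction xs generalizing F with
  | nil => simp [altPick, h0]
  | cons x xs ih =>
    simp only [List.cons_append, altPick]
    rw [hF xs fun y hy => by simp [hy]]
    congr 1
    refine ih (F := fun ys => F (x :: ys)) fun ys hys => ?_
    rw [← List.cons_append]
    refine hF _ fun y hy => ?_
    rcases List.mem_cons.1 hy with rfl | hy
    · simp
    · simp [hys y hy]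

/-- A trailing zero has only trivial factors in the hook weight, and no row of positive length can
pick it. -/
theorem factorialValue_append_zero {as : List ℕ} (has : ∀ a ∈ as, 0 < a) {xs : List ℕ}
    (hpos : ∀ x ∈ xs, 0 < x) : factorialValue as (xs ++ [0]) = factorialValue as xs := by
  induction as generalizing xs with
  | nil => exact hookWeight_append_zero hpos
  | cons a as ih =>
    refine altPick_append_zero ?_ fun ys hys =>
      ih (fun b hb => has b (by simp [hb])) fun y hy => hpos y (hys y hy)
    rw [invFactorial, if_neg]
    have := has a (by simp)
    omega

theorem hookWeight_repeat (p s : List ℕ) (x : ℕ) : hookWeight (p ++ x :: x :: s) = 0 := by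
  induction p with
  | nil => simp [hookWeight]
  | cons y p ih => simp [hookWeight, ih]

/-- Picking either of the two equal neighbours leaves the same list with opposite signs; any other
pick leaves them adjacent, where `F` vanishes. -/
theorem altPick_repeat {φ : ℕ → ℚ} {F : List ℕ → ℚ} (p s : List ℕ) (x : ℕ)
    (hF : ∀ p s, F (p ++ x :: x :: s) = 0) :
    altPick (fun y ys => φ y * F ys) (p ++ x :: x :: s) = 0 := by
  induction p generalizing F with
  | nil =>
    have h0 : ∀ (f : ℕ → ℚ) (zs : List ℕ), altPick (fun y _ => f y * 0) zs = 0 := by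
      intro f zs
      have := altPick_mul_left 0 (fun (y : ℕ) (_ : List ℕ) => f y) zs
      simpa using this
    have h1 : ∀ ys, F (x :: x :: ys) = 0 := fun ys => hF [] ys
    simp only [List.nil_append, altPick, h1, h0]
    ring
  | cons y p ih =>
    simp only [List.cons_append, altPick]
    rw [hF, ih (F := fun ys => F (y :: ys)) fun p s => hF (y :: p) s]
    ring

theorem factorialValue_repeat (as p s : List ℕ) (x : ℕ) :
    factorialValue as (p ++ x :: x :: s) = 0 := by
  induction as generalizing p s with
  | nil => exact hookWeight_repeat p s x
  | cons a as ih => exact altPick_repeat p s x fun p s => ih p s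

theorem exists_of_altPick_ne_zero {φ : ℕ → ℚ} {F : List ℕ → ℚ} {xs : List ℕ}
    (h : altPick (fun y ys => φ y * F ys) xs ≠ 0) :
    ∃ p y s, xs = p ++ y :: s ∧ φ y ≠ 0 ∧ F (p ++ s) ≠ 0 := by
  induction xs generalizing F with
  | nil => simp [altPick] at h
  | cons x xs ih =>
    by_cases h1 : φ x * F xs = 0
    · simp only [altPick, h1, zero_sub, neg_ne_zero] at h
      obtain ⟨p, y, s, rfl, hy, hF⟩ := ih h
      exact ⟨x :: p, y, s, rfl, hy, hF⟩
    · exact ⟨[], x, xs, rfl, left_ne_zero_of_mul h1, right_ne_zero_of_mul h1⟩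

theorem factorialValue_self {as : List ℕ} (has : as.Pairwise (· > ·)) :
    factorialValue as as = 1 := by
  induction as with
  | nil => rfl
  | cons a as ih =>
    obtain ⟨ha, has⟩ := List.pairwise_cons.1 has
    have h0 : altPick (fun y ys => invFactorial a y * factorialValue as (a :: ys)) as = 0 := by
      by_contra h
      obtain ⟨p, y, s, rfl, hy, -⟩ := exists_of_altPick_ne_zero (F := fun ys => factorialValue _ (a :: ys)) h
      have := ha y (by simp)
      rw [invFactorial, if_neg (by omega)] at hy
      exact hy rfl
    rw [factorialValue, altPick, h0, ih has]
    simp [invFactorial]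

/-- A nonvanishing term matches each row with an entry at least as large. The bound on the sums then
forces equality throughout. -/
theorem eq_of_factorialValue_ne_zero {as xs : List ℕ} (has : as.Pairwise (· > ·))
    (hxs : xs.Pairwise (· > ·)) (hpos : ∀ x ∈ xs, 0 < x) (hle : xs.sum ≤ as.sum)
    (h : factorialValue as xs ≠ 0) : xs = as := by
  induction as generalizing xs with
  | nil =>
    rcases xs with _ | ⟨x, xs⟩
    · rfl
    · have := hpos x (by simp)
      simp only [List.sum_cons, List.sum_nil] at hle
      omega
  | cons a as ih =>
    obtain ⟨ha, has⟩ := List.pairwise_cons.1 has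
    obtain ⟨p, y, s, rfl, hy, hF⟩ := exists_of_altPick_ne_zero h
    have hay : a ≤ y := by
      by_contra hay
      rw [invFactorial, if_neg hay] at hy
      exact hy rfl
    simp only [List.sum_append, List.sum_cons] at hle
    have hsub : (p ++ s).Sublist (p ++ y :: s) := by simp
    have e := ih has (hxs.sublist hsub) (fun x hx => hpos x (hsub.subset hx))
      (by rw [List.sum_append]; omega) hF
    have es := congrArg List.sum e
    rw [List.sum_append] at es
    have hya : y = a := by omega
    subst hya
    -- The picked entry, now equal to the largest row, must come first: an entry before it would be
    -- larger than all rows but belong to the remaining ones.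
    rcases p with _ | ⟨z, p⟩
    · rw [List.nil_append] at e ⊢
      rw [e]
    · have h1 : y < z := (List.pairwise_cons.1 hxs).1 y (by simp)
      have h2 := ha z (by rw [← e]; simp)
      omega

/-- The hook weight turns values of factorial Schur `P`-functions into alternating sums. -/
theorem rowSum_mul_hookWeight (as : List ℕ) {xs : List ℕ} (hxs : xs.Nodup)
    (hpos : ∀ x ∈ xs, 0 < x) :
    rowSum (as.map fun a => descPochhammer ℚ a) (xs.map fun x : ℕ => (x : ℚ)) * hookWeight xs =
      factorialValue as xs := by
  -- One row at a time. Each entry z in front of the picked y leaves (y + z)/(y - z) · (z - y)/(z +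
  -- y) = -1, which produces the alternating sign, and the descending power over y! leaves 1/(y -
  -- a)!. The function `F` is arbitrary so that it can absorb the factors of the head.
  have key : ∀ (a : ℕ) (F : List ℕ → ℚ) (xs : List ℕ), xs.Nodup → (∀ x ∈ xs, 0 < x) →
      pick (fun (y : ℕ) ys => (y.descFactorial a : ℚ) * ratio (y : ℚ) (ys.map fun x : ℕ => (x : ℚ)) *
        F ys) xs * hookWeight xs = altPick (fun y ys => invFactorial a y * (F ys * hookWeight ys)) xs := by
    intro a F xs hxs hpos
    induction xs generalizing F with
    | nil => simp [pick, altPick]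
    | cons x xs ih =>
      obtain ⟨hx, hxs⟩ := List.nodup_cons.1 hxs
      have hx0 : (0 : ℚ) < x := by exact_mod_cast hpos x (by simp)
      have hxx : ∀ y ∈ xs, (x : ℚ) - y ≠ 0 ∧ (x : ℚ) + y ≠ 0 := fun y hy =>
        ⟨sub_ne_zero.2 fun e => hx ((Nat.cast_injective e : x = y) ▸ hy), by positivity⟩
      have hr : ratio (x : ℚ) (xs.map fun x : ℕ => (x : ℚ)) *
          (xs.map fun y : ℕ => ((x : ℚ) - y) / (x + y)).prod = 1 := by
        rw [ratio, List.map_map, ← List.prod_map_mul, List.prod_eq_one]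
        intro r hr
        obtain ⟨y, hy, rfl⟩ := List.mem_map.1 hr
        obtain ⟨h1, h2⟩ := hxx y hy
        simp only [Function.comp_apply]
        field_simp
      have hd : (x.descFactorial a : ℚ) * (1 / (x.factorial : ℚ)) = invFactorial a x := by
        rw [invFactorial]
        split_ifs with h
        · rw [← Nat.factorial_mul_descFactorial h]
          have h1 : ((x - a).factorial : ℚ) ≠ 0 := by positivity
          have h2 : (x.descFactorial a : ℚ) ≠ 0 := by
            exact_mod_cast fun e => (Nat.descFactorial_eq_zero_iff_lt.1 e).not_ge h
          push_cast
          field_simp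
        · rw [Nat.descFactorial_of_lt (not_le.1 h)]
          simp
      rw [pick, altPick, add_mul, sub_eq_add_neg]
      congr 1
      · rw [hookWeight, ← hd]
        linear_combination ((x.descFactorial a : ℚ) * (1 / (x.factorial : ℚ)) * F xs * hookWeight xs) * hr
      · have ih' := ih (fun ys => F (x :: ys) * (1 / (x.factorial : ℚ) *
          (ys.map fun y : ℕ => ((x : ℚ) - y) / (x + y)).prod)) hxs fun y hy => hpos y (by simp [hy])
        have e : (fun (y : ℕ) (ys : List ℕ) => invFactorial a y * (F (x :: ys) * hookWeight (x :: ys))) =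
            fun y ys => invFactorial a y * (F (x :: ys) * (1 / (x.factorial : ℚ) *
              (ys.map fun y : ℕ => ((x : ℚ) - y) / (x + y)).prod) * hookWeight ys) := by
          funext y ys
          rw [hookWeight]
          ring
        rw [e, ← ih', hookWeight, ← neg_mul, ← mul_assoc]
        congr 1
        rw [← neg_one_mul (pick _ _), ← pick_mul_left, ← pick_mul_right]
        refine pick_congr fun y ys hy => ?_
        obtain ⟨h1, h2⟩ := hxx y (hy.subset (by simp))
        have h3 : (y : ℚ) - x ≠ 0 := by rw [← neg_sub]; exact neg_ne_zero.2 h1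
        have h4 : ((y : ℚ) + x) / (y - x) * (((x : ℚ) - y) / (x + y)) = -1 := by
          field_simp
          ring
        rw [← (hy.map _).prod_eq, List.map_cons, List.map_cons, List.prod_cons, ratio_cons]
        linear_combination ((y.descFactorial a : ℚ) * ratio (y : ℚ) (ys.map fun x : ℕ => (x : ℚ)) *
          F (x :: ys) * (1 / (x.factorial : ℚ)) *
          (ys.map fun y : ℕ => ((x : ℚ) - y) / (x + y)).prod) * h4
  induction as generalizing xs with
  | nil => simp [rowSum, factorialValue]
  | cons a as ih =>
    have hp : ∀ (f : ℚ → List ℚ → ℚ) (zs : List ℕ), pick f (zs.map fun x : ℕ => (x : ℚ)) =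
        pick (fun (y : ℕ) ys => f y (ys.map fun x : ℕ => (x : ℚ))) zs := by
      intro f zs
      induction zs generalizing f with
      | nil => rfl
      | cons z zs ih => simp [pick, ih]
    rw [List.map_cons, rowSum, hp, factorialValue]
    have e := key a (fun ys => rowSum (as.map fun a => descPochhammer ℚ a) (ys.map fun x : ℕ => (x : ℚ)))
      xs hxs hpos
    have e2 : ∀ y : ℕ, Polynomial.aeval (y : ℚ) (descPochhammer ℚ a) = (y.descFactorial a : ℚ) := by
      intro y
      rw [Polynomial.aeval_def, ← Polynomial.eval_map, Algebra.algebraMap_self, Polynomial.map_id, descPochhammer_eval_eq_descFactorial]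
    simp only [e2]
    rw [e]
    refine altPick_congr fun y ys hy => ?_
    rw [ih (List.nodup_cons.1 (hy.nodup_iff.2 hxs)).2 fun z hz => hpos z (hy.subset (by simp [hz]))]


/-! ### Schur `P`-functions as polynomials in the odd power sums -/

section Permutations

variable {K : Type*} [Field K] [Algebra ℚ K]

/-- A permutation of `Fin (N + 1)` is a choice of the image `i` of `0` and a permutation of the rest. -/
noncomputable def consPerm {N : ℕ} (q : Fin (N + 1) × Equiv.Perm (Fin N)) :
    Equiv.Perm (Fin (N + 1)) :=
  (Equiv.Perm.decomposeFin.symm (0, q.2)).trans q.1.cycleRange.symm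

theorem consPerm_zero {N : ℕ} (q : Fin (N + 1) × Equiv.Perm (Fin N)) : consPerm q 0 = q.1 := by
  simp [consPerm]

theorem consPerm_succ {N : ℕ} (q : Fin (N + 1) × Equiv.Perm (Fin N)) (j : Fin N) :
    consPerm q j.succ = q.1.succAbove (q.2 j) := by
  simp [consPerm]

theorem consPerm_bijective (N : ℕ) : Function.Bijective (consPerm (N := N)) := by
  rw [Fintype.bijective_iff_injective_and_card]
  constructor
  · rintro ⟨i, e⟩ ⟨i', e'⟩ h
    have h0 : i = i' := by
      have := congrArg (fun σ => σ 0) h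
      simpa only [consPerm_zero] using this
    subst h0
    refine Prod.ext rfl (Equiv.ext fun j => ?_)
    have h1 := consPerm_succ (i, e) j
    rw [h, consPerm_succ] at h1
    exact (Fin.succAbove_right_injective h1).symm
  · simp [Fintype.card_perm, Nat.factorial_succ]

/-- The contribution of the position `i` to the term of a permuted sequence `y`. -/
noncomputable def positionFactor {N : ℕ} (us : List (Polynomial ℚ)) (y : Fin N → K) (i : Fin N) : K :=
  (us[(i : ℕ)]?).elim 1 fun u =>
    Polynomial.aeval (y i) u * ∏ j ∈ Ioi i, (y i + y j) / (y i - y j)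

/-- The rows successively choose the images of the first positions; the remaining positions carry
the factor 1 and can be permuted freely. -/
theorem sum_perm_positionFactor (us : List (Polynomial ℚ)) {N : ℕ} (h : us.length ≤ N)
    (x : Fin N → K) :
    ∑ ω : Equiv.Perm (Fin N), ∏ i, positionFactor us (fun k => x (ω k)) i =
      ((N - us.length).factorial : K) * rowSum us (List.ofFn x) := by
  induction us generalizing N with
  | nil => simp [positionFactor, rowSum, Fintype.card_perm]
  | cons u us ih =>
    obtain ⟨M, rfl⟩ : ∃ M, N = M + 1 := Nat.exists_eq_succ_of_ne_zero (by simp at h; omega)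
    rw [List.length_cons] at h
    rw [← (consPerm_bijective M).sum_comp, Fintype.sum_prod_type, rowSum, pick_ofFn, Finset.mul_sum]
    refine Finset.sum_congr rfl fun i _ => ?_
    have hi := ih (N := M) (by omega) fun j => x (i.succAbove j)
    rw [show M + 1 - (u :: us).length = M - us.length by simp, mul_left_comm, ← hi, Finset.mul_sum]
    refine Finset.sum_congr rfl fun e _ => ?_
    rw [Fin.prod_univ_succ]
    congr 1
    · simp only [positionFactor, Fin.val_zero, List.getElem?_cons_zero, Option.elim_some,
        Fin.prod_Ioi_zero, consPerm_zero, consPerm_succ]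
      congr 1
      rw [ratio, List.map_ofFn, List.prod_ofFn]
      exact Equiv.prod_comp e fun j => (x i + x (i.succAbove j)) / (x i - x (i.succAbove j))
    · refine Finset.prod_congr rfl fun j _ => ?_
      simp only [positionFactor, Fin.val_succ, List.getElem?_cons_succ, Fin.prod_Ioi_succ,
        consPerm_succ]

end Permutations

/-- The homomorphism from `OddPower` to sequences of polynomials. -/
noncomputable def toSeq : OddPower →ₐ[ℚ] PolySeq :=
  MvPolynomial.aeval fun m => powerSum (2 * m + 1)

theorem range_toSeq : toSeq.range = Gam := by
  rw [toSeq, Gam, Algebra.adjoin_range_eq_range_aeval]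

theorem aeval_toSeq {K : Type*} [Field K] [Algebra ℚ K] {N : ℕ} (x : Fin N → K) (g : OddPower) :
    MvPolynomial.aeval x (toSeq g N) = evalList (List.ofFn x) g := by
  have : ((MvPolynomial.aeval x).comp
      (Pi.evalAlgHom ℚ (fun N => MvPolynomial (Fin N) ℚ) N)).comp toSeq =
      evalList (List.ofFn x) := by
    refine MvPolynomial.algHom_ext fun m => ?_
    simp [toSeq, powerSum, MvPolynomial.psum, evalList_X, List.map_ofFn, List.sum_ofFn]
  exact DFunLike.congr_fun this g

theorem ratVar_injective (N : ℕ) : Function.Injective (ratVar (N := N)) := fun _ _ h =>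
  MvPolynomial.X_injective (IsFractionRing.injective (MvPolynomial (Fin N) ℚ) (RatFun N) h)

theorem aeval_ratVar {N : ℕ} (f : MvPolynomial (Fin N) ℚ) :
    MvPolynomial.aeval (ratVar (N := N)) f = algebraMap _ (RatFun N) f := by
  have : MvPolynomial.aeval (ratVar (N := N)) =
      IsScalarTower.toAlgHom ℚ (MvPolynomial (Fin N) ℚ) (RatFun N) :=
    MvPolynomial.algHom_ext fun i => by simp [ratVar]
  exact DFunLike.congr_fun this f

theorem schurTerm_eq_prod (u : ℕ → Polynomial ℚ) (lam : StrictPartition) (N : ℕ)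
    (ω : Equiv.Perm (Fin N)) :
    schurTerm u lam N ω = ∏ i, positionFactor (lam.parts.map u) (fun k => ratVar (ω k)) i := by
  rw [schurTerm, Finset.prod_filter, Finset.prod_filter, ← Finset.prod_mul_distrib]
  refine Finset.prod_congr rfl fun i _ => ?_
  rw [positionFactor]
  by_cases h : (i : ℕ) < lam.length
  · have h' : (i : ℕ) < lam.parts.length := h
    simp [h, StrictPartition.part, h']
  · have h' : ¬ (i : ℕ) < lam.parts.length := h
    simp [h, not_lt.1 h']

/-- The variables are distinct elements of the field `RatFun N`, so evaluating the row construction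
at them gives the defining symmetrised sum. If there are more rows than variables, both sides are
zero. -/
theorem schurSeq_eq_toSeq {u : ℕ → Polynomial ℚ} (hu : ∀ k, 0 < k → Polynomial.X ∣ u k)
    (lam : StrictPartition) : schurSeq u lam = toSeq (rowProduct (lam.parts.map u)) := by
  funext N
  refine IsFractionRing.injective (MvPolynomial (Fin N) ℚ) (RatFun N) ?_
  have hchar : CharZero (RatFun N) := algebraRat.charZero _
  rw [algebraMap_schurSeq, ← aeval_ratVar, aeval_toSeq, evalList_rowProduct (by
    intro v hv
    obtain ⟨k, hk, rfl⟩ := List.mem_map.1 hv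
    exact hu k (lam.pos k hk)) (List.nodup_ofFn.2 (ratVar_injective N)), schurRat]
  split_ifs with h
  · have hl : (lam.parts.map u).length ≤ N := by simpa [StrictPartition.length] using h
    simp only [schurTerm_eq_prod]
    rw [sum_perm_positionFactor _ hl, List.length_map, ← mul_assoc]
    have hf : ((N - lam.length).factorial : RatFun N) ≠ 0 :=
      Nat.cast_ne_zero.2 (Nat.factorial_ne_zero _)
    have : lam.parts.length = lam.length := rfl
    rw [this, one_div_mul_cancel hf, one_mul]
  · rw [rowSum_eq_zero]
    simpa [StrictPartition.length] using h

theorem evalAt_toSeq (g : OddPower) (lam : StrictPartition) :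
    evalAt (toSeq g) lam = evalList (lam.parts.map fun x : ℕ => (x : ℚ)) g := by
  have h := aeval_toSeq (fun i : Fin lam.length => (lam.part i : ℚ)) g
  rw [MvPolynomial.aeval_eq_eval] at h
  rw [evalAt]
  refine h.trans ?_
  congr 2
  refine List.ext_getElem (by simp [StrictPartition.length]) fun i h1 h2 => ?_
  have h3 : i < lam.parts.length := by simpa using h2
  simp [StrictPartition.part, h3]


/-! ### Factorial Schur `P`-functions are linearly independent on strict partitions -/

/-- The factorial Schur `P`-function as a polynomial in the odd power sums. -/
noncomputable def facP (lam : StrictPartition) : OddPower :=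
  rowProduct (lam.parts.map fun a => descPochhammer ℚ a)

/-- Evaluation at a strict partition. -/
noncomputable def evalPart (lam : StrictPartition) : OddPower →ₐ[ℚ] ℚ :=
  evalList (lam.parts.map fun x : ℕ => (x : ℚ))

/-- An element of `OddPower` as a function on strict partitions. -/
noncomputable def evalAll : OddPower →ₗ[ℚ] StrictPartition → ℚ :=
  LinearMap.pi fun lam => (evalPart lam).toLinearMap

theorem StrictPartition.nodup (lam : StrictPartition) : lam.parts.Nodup :=
  lam.decreasing.imp ne_of_gt

theorem StrictPartition.nodup_cast (lam : StrictPartition) :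
    (lam.parts.map fun x : ℕ => (x : ℚ)).Nodup :=
  lam.nodup.map Nat.cast_injective

theorem X_dvd_descPochhammer {k : ℕ} (hk : 0 < k) : Polynomial.X ∣ descPochhammer ℚ k := by
  obtain ⟨n, rfl⟩ := Nat.exists_eq_succ_of_ne_zero hk.ne'
  rw [descPochhammer_succ_left]
  exact dvd_mul_right _ _

theorem evalPart_facP_mul_hookWeight (lam nu : StrictPartition) :
    evalPart lam (facP nu) * hookWeight lam.parts = factorialValue nu.parts lam.parts := by
  rw [evalPart, facP, evalList_rowProduct (by
    intro v hv
    obtain ⟨k, hk, rfl⟩ := List.mem_map.1 hv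
    exact X_dvd_descPochhammer (nu.pos k hk)) lam.nodup_cast,
    rowSum_mul_hookWeight nu.parts lam.nodup lam.pos]

theorem evalPart_facP_eq_zero {lam nu : StrictPartition} (hne : lam ≠ nu)
    (hle : lam.size ≤ nu.size) : evalPart lam (facP nu) = 0 := by
  have h := evalPart_facP_mul_hookWeight lam nu
  have h0 : factorialValue nu.parts lam.parts = 0 := by
    by_contra h0
    exact hne (StrictPartition.ext
      (eq_of_factorialValue_ne_zero nu.decreasing lam.decreasing lam.pos hle h0))
  rw [h0] at h
  exact (mul_eq_zero.1 h).resolve_right (hookWeight_pos lam.decreasing).ne'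

theorem evalPart_facP_self_ne_zero (lam : StrictPartition) : evalPart lam (facP lam) ≠ 0 := by
  intro h
  have h1 := evalPart_facP_mul_hookWeight lam lam
  rw [h, zero_mul, factorialValue_self lam.decreasing] at h1
  exact zero_ne_one h1

/-- Triangularity: evaluating a relation at λ kills every other term of size at least |λ|, and the
smaller ones have zero coefficient by induction on the size. -/
theorem linearIndependent_evalAll_facP :
    LinearIndependent ℚ fun nu : StrictPartition => evalAll (facP nu) := by
  rw [linearIndependent_iff']
  intro s c hc
  have key : ∀ n, ∀ lam ∈ s, lam.size = n → c lam = 0 := by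
    intro n
    induction n using Nat.strong_induction_on with
    | _ n ih =>
    intro lam hlam hn
    have h := congrFun hc lam
    rw [Finset.sum_apply, Finset.sum_eq_single_of_mem lam hlam] at h
    · exact (mul_eq_zero.1 h).resolve_right (evalPart_facP_self_ne_zero lam)
    · intro nu hnu hne
      rcases lt_or_ge nu.size lam.size with hlt | hge
      · rw [ih nu.size (hn ▸ hlt) nu hnu rfl, zero_smul]
        rfl
      · have : evalAll (facP nu) lam = 0 := evalPart_facP_eq_zero hne.symm hge
        rw [Pi.smul_apply, this, smul_zero]
  exact fun lam hlam => key _ lam hlam rfl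

/-! ### The weight filtration -/

/-- The weight of a monomial, in which `p_r` has weight `r`. -/
noncomputable def oddWeight : (ℕ →₀ ℕ) →+ ℕ := Finsupp.weight fun j => 2 * j + 1

/-- The polynomials in the odd power sums of weight less than `n`. -/
noncomputable def weightLT (n : ℕ) : Submodule ℚ OddPower :=
  MvPolynomial.restrictSupport ℚ {m | oddWeight m < n}

theorem mem_weightLT {n : ℕ} {g : OddPower} :
    g ∈ weightLT n ↔ ∀ m ∈ g.support, oddWeight m < n := Iff.rfl

/-- Polynomials in `t` over `OddPower` of weight less than `n`, where `t` has weight `1`. -/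
def jointWeightLT (n : ℕ) : Submodule ℚ (Polynomial OddPower) where
  carrier := {H | ∀ j, ∀ m, (H.coeff j).coeff m ≠ 0 → oddWeight m + j < n}
  zero_mem' := by simp
  add_mem' := by
    intro a b ha hb j m h
    by_cases h1 : (a.coeff j).coeff m = 0
    · refine hb j m fun h2 => h ?_
      rw [Polynomial.coeff_add, MvPolynomial.coeff_add, h1, h2, add_zero]
    · exact ha j m h1
  smul_mem' := by
    intro c a ha j m h
    refine ha j m fun h1 => h ?_
    rw [Polynomial.coeff_smul, MvPolynomial.coeff_smul, h1, smul_zero]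

/-- The bounds are strict: weights at most a and at most b - 1 add up to less than a + b, hence the
`a + 1` in one factor only. -/
theorem mul_mem_jointWeightLT {a b : ℕ} {G H : Polynomial OddPower} (hG : G ∈ jointWeightLT (a + 1))
    (hH : H ∈ jointWeightLT b) : G * H ∈ jointWeightLT (a + b) := by
  intro j m h
  rw [Polynomial.coeff_mul, MvPolynomial.coeff_sum] at h
  obtain ⟨p, hp, h⟩ := Finset.exists_ne_zero_of_sum_ne_zero h
  rw [MvPolynomial.coeff_mul] at h
  obtain ⟨q, hq, h⟩ := Finset.exists_ne_zero_of_sum_ne_zero h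
  have h1 := hG p.1 q.1 (left_ne_zero_of_mul h)
  have h2 := hH p.2 q.2 (right_ne_zero_of_mul h)
  rw [← mem_antidiagonal.1 hp, ← mem_antidiagonal.1 hq, map_add]
  omega

theorem mul_mem_weightLT {a b : ℕ} {g h : OddPower} (hg : g ∈ weightLT (a + 1))
    (hh : h ∈ weightLT b) : g * h ∈ weightLT (a + b) := by
  rw [mem_weightLT]
  intro m hm
  rw [MvPolynomial.mem_support_iff, MvPolynomial.coeff_mul] at hm
  obtain ⟨q, hq, h⟩ := Finset.exists_ne_zero_of_sum_ne_zero hm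
  have h1 := mem_weightLT.1 hg q.1 (MvPolynomial.mem_support_iff.2 (left_ne_zero_of_mul h))
  have h2 := mem_weightLT.1 hh q.2 (MvPolynomial.mem_support_iff.2 (right_ne_zero_of_mul h))
  rw [← mem_antidiagonal.1 hq, map_add]
  omega

theorem weightLT_mono {a b : ℕ} (h : a ≤ b) : weightLT a ≤ weightLT b :=
  MvPolynomial.restrictSupport_mono _ fun _ hm => lt_of_lt_of_le hm h

theorem C_mem_weightLT (c : ℚ) : (MvPolynomial.C c : OddPower) ∈ weightLT 1 := by
  rw [MvPolynomial.C_apply, weightLT, MvPolynomial.monomial_mem_restrictSupport]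
  exact Or.inl (by simp)

theorem X_mem_weightLT (j : ℕ) : (MvPolynomial.X j : OddPower) ∈ weightLT (2 * j + 2) := by
  rw [MvPolynomial.X, weightLT, MvPolynomial.monomial_mem_restrictSupport]
  exact Or.inl (by simp [oddWeight, Finsupp.weight_single])

theorem rowP_mem_weightLT (a : ℕ) : rowP a ∈ weightLT (a + 1) := by
  induction a using Nat.strong_induction_on with
  | _ a ih =>
  rcases a with _ | a
  · rw [rowP_zero]; exact C_mem_weightLT _
  · rw [rowP, ← zero_add (a + 1 + 1)]
    refine mul_mem_weightLT (C_mem_weightLT _) (Submodule.sum_mem _ fun m _ => ?_)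
    have hm := m.2
    have := mul_mem_weightLT (a := 2 * m + 1) (X_mem_weightLT m) (ih (a - 2 * m) (by omega))
    rwa [show 2 * (m : ℕ) + 1 + (a - 2 * m + 1) = a + 1 + 1 by omega] at this

theorem removeVar_mem {n : ℕ} {g : OddPower} (hg : g ∈ weightLT n) :
    removeVar g ∈ jointWeightLT n := by
  have hone : (1 : Polynomial OddPower) ∈ jointWeightLT 1 := by
    intro j m h
    rw [Polynomial.coeff_one] at h
    split_ifs at h with hj
    · rw [MvPolynomial.coeff_one] at h
      split_ifs at h with hm
      · subst hj; subst hm; simp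
      · exact absurd rfl h
    · exact absurd (MvPolynomial.coeff_zero m) h
  have hX : ∀ j, removeVar (MvPolynomial.X j) ∈ jointWeightLT (2 * j + 1 + 1) := by
    intro i
    have e : removeVar (MvPolynomial.X i) = Polynomial.C (MvPolynomial.X i) -
      Polynomial.X ^ (2 * i + 1) := by simp [removeVar]
    rw [e]
    refine Submodule.sub_mem _ ?_ ?_
    · intro j m h
      rw [Polynomial.coeff_C] at h
      split_ifs at h with hj
      · have := mem_weightLT.1 (X_mem_weightLT i) m (MvPolynomial.mem_support_iff.2 h)
        omega
      · exact absurd (MvPolynomial.coeff_zero m) h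
    · intro j m h
      rw [Polynomial.coeff_X_pow] at h
      split_ifs at h with hj
      · have := mem_weightLT.1 (C_mem_weightLT 1) m (MvPolynomial.mem_support_iff.2
          (by rwa [MvPolynomial.C_1]))
        omega
      · exact absurd (MvPolynomial.coeff_zero m) h
  have hmon : ∀ m : ℕ →₀ ℕ, removeVar (MvPolynomial.monomial m 1) ∈
      jointWeightLT (oddWeight m + 1) := by
    intro m
    induction m using Finsupp.induction_linear with
    | zero => simpa using hone
    | add a b ha hb =>
      have := mul_mem_jointWeightLT ha hb
      rwa [← map_mul, MvPolynomial.monomial_mul, mul_one, ← add_assoc, ← map_add] at this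
    | single j e =>
      rw [← MvPolynomial.X_pow_eq_monomial]
      have hw : oddWeight (Finsupp.single j e) = e * (2 * j + 1) := by
        simp [oddWeight, Finsupp.weight_single]
      rw [hw]
      clear hw
      induction e with
      | zero => simpa using hone
      | succ e ih =>
        have := mul_mem_jointWeightLT ih (hX j)
        rw [← map_mul, ← pow_succ] at this
        rwa [show (e + 1) * (2 * j + 1) + 1 = e * (2 * j + 1) + (2 * j + 1 + 1) by ring]
  rw [g.as_sum, map_sum]
  refine Submodule.sum_mem _ fun m hm => ?_
  have e : MvPolynomial.monomial m (g.coeff m) = g.coeff m • MvPolynomial.monomial m (1 : ℚ) := by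
    rw [MvPolynomial.smul_monomial, smul_eq_mul, mul_one]
  rw [e, map_smul]
  refine Submodule.smul_mem _ _ fun j m' h => lt_of_lt_of_le (hmon m j m' h) ?_
  exact mem_weightLT.1 hg m hm

theorem rowMap_mem {n : ℕ} {H : Polynomial OddPower} (hH : H ∈ jointWeightLT n) :
    rowMap H ∈ weightLT n := by
  rw [rowMap_eq_sum (Nat.lt_succ_self _)]
  refine Submodule.sum_mem _ fun j _ => ?_
  rw [mem_weightLT]
  intro m hm
  rw [MvPolynomial.mem_support_iff, MvPolynomial.coeff_mul] at hm
  obtain ⟨q, hq, h⟩ := Finset.exists_ne_zero_of_sum_ne_zero hm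
  have h1 := hH j q.1 (left_ne_zero_of_mul h)
  have h2 := mem_weightLT.1 (rowP_mem_weightLT j) q.2
    (MvPolynomial.mem_support_iff.2 (right_ne_zero_of_mul h))
  rw [← mem_antidiagonal.1 hq, map_add]
  omega

theorem addRow_mem {n d : ℕ} {u : Polynomial ℚ} (hu : u.natDegree ≤ d) {g : OddPower}
    (hg : g ∈ weightLT n) : addRow u g ∈ weightLT (d + n) := by
  refine rowMap_mem (mul_mem_jointWeightLT ?_ (removeVar_mem hg))
  intro j m h
  change ((u.map (algebraMap ℚ OddPower)).coeff j).coeff m ≠ 0 at h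
  rw [Polynomial.coeff_map, MvPolynomial.algebraMap_eq] at h
  have h1 := mem_weightLT.1 (C_mem_weightLT _) m (MvPolynomial.mem_support_iff.2 h)
  have h2 : j ≤ u.natDegree := by
    by_contra hj
    rw [Polynomial.coeff_eq_zero_of_natDegree_lt (not_le.1 hj)] at h
    simp at h
  omega

theorem rowProduct_mem {u : ℕ → Polynomial ℚ} (hu : ∀ k, (u k).natDegree ≤ k) (as : List ℕ) :
    rowProduct (as.map u) ∈ weightLT (as.sum + 1) := by
  induction as with
  | nil => exact C_mem_weightLT 1
  | cons a as ih =>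
    rw [List.map_cons, rowProduct_cons, List.sum_cons, add_assoc]
    exact addRow_mem (hu a) ih

/-- Ordinary and descending powers of the same degree are both monic, so exchanging them in any row
changes only terms of lower weight. -/
theorem powP_sub_mem {as : List ℕ} (has : ∀ a ∈ as, 0 < a) :
    powP as - rowProduct (as.map fun a => descPochhammer ℚ a) ∈ weightLT as.sum := by
  induction as with
  | nil => simp [powP]
  | cons a as ih =>
    have ha := has a (by simp)
    rw [powP_cons, List.map_cons, rowProduct_cons, List.sum_cons]
    set f := rowProduct (as.map fun a => descPochhammer ℚ a)
    have e : addRow (Polynomial.X ^ a) (powP as) - addRow (descPochhammer ℚ a) f =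
        addRow (Polynomial.X ^ a) (powP as - f) +
          addRow (Polynomial.X ^ a - descPochhammer ℚ a) f := by
      rw [map_sub, addRow_sub]; ring
    rw [e]
    refine Submodule.add_mem _ (addRow_mem (by simp) (ih fun b hb => has b (by simp [hb]))) ?_
    have hdeg : (Polynomial.X ^ a - descPochhammer ℚ a).natDegree ≤ a - 1 := by
      have h1 : (Polynomial.X ^ a - descPochhammer ℚ a).degree < (a : WithBot ℕ) := by
        have := Polynomial.degree_sub_lt_left (p := Polynomial.X ^ a) (q := descPochhammer ℚ a) (by
          rw [Polynomial.degree_X_pow,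
            Polynomial.degree_eq_natDegree (monic_descPochhammer ℚ a).ne_zero,
            descPochhammer_natDegree]) (pow_ne_zero _ Polynomial.X_ne_zero) (by
          rw [(monic_descPochhammer ℚ a).leadingCoeff, Polynomial.leadingCoeff_X_pow])
        rwa [Polynomial.degree_X_pow] at this
      rcases eq_or_ne (Polynomial.X ^ a - descPochhammer ℚ a) 0 with h0 | h0
      · simp [h0]
      · have := (Polynomial.natDegree_lt_iff_degree_lt h0).2 h1
        omega
    have := addRow_mem hdeg (rowProduct_mem (fun k => (descPochhammer_natDegree ℚ k).le) as)
    rwa [show a - 1 + (as.sum + 1) = a + as.sum by omega] at this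

theorem facP_mem (lam : StrictPartition) : facP lam ∈ weightLT (lam.size + 1) :=
  rowProduct_mem (fun k => (descPochhammer_natDegree ℚ k).le) lam.parts

theorem exists_mem_weightLT (g : OddPower) : ∃ n, g ∈ weightLT n :=
  ⟨g.support.sup oddWeight + 1, fun _ hm => Nat.lt_succ_of_le (Finset.le_sup (f := oddWeight) hm)⟩

theorem eq_zero_of_mem_weightLT_zero {g : OddPower} (hg : g ∈ weightLT 0) : g = 0 := by
  rw [← MvPolynomial.support_eq_empty, Finset.eq_empty_iff_forall_notMem]
  exact fun m hm => absurd (mem_weightLT.1 hg m hm) (Nat.not_lt_zero _)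

/-! ### Counting -/

theorem pairwiseDisjoint_SP (s : Set ℕ) : s.PairwiseDisjoint SP :=
  fun _ _ _ _ hne => Finset.disjoint_left.2 fun _ h h' =>
    hne ((mem_SP.1 h).symm.trans (mem_SP.1 h'))

/-- The strict partitions of size less than `n`. -/
noncomputable def partitionsLT (n : ℕ) : Finset StrictPartition :=
  (Finset.range n).disjiUnion SP (pairwiseDisjoint_SP _)

theorem mem_partitionsLT {n : ℕ} {lam : StrictPartition} :
    lam ∈ partitionsLT n ↔ lam.size < n := by
  rw [partitionsLT, Finset.mem_disjiUnion]
  simp [mem_SP]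

theorem card_partitionsLT (n : ℕ) : (partitionsLT n).card = ∑ k ∈ range n, (SP k).card :=
  Finset.card_disjiUnion _ _ _

/-- An inequality suffices, since linear independence supplies the reverse estimate in the dimension
count. -/
theorem card_distincts_le (k : ℕ) : (Nat.Partition.distincts k).card ≤ (SP k).card := by
  have hsort : ∀ p ∈ Nat.Partition.distincts k, (p.parts.sort (· ≥ ·)).Pairwise (· > ·) := by
    intro p hp
    have hnd : p.parts.Nodup := by simpa [Nat.Partition.distincts] using hp
    have h1 := Multiset.pairwise_sort p.parts (· ≥ ·)
    have h2 : (p.parts.sort (· ≥ ·)).Nodup := by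
      rw [← Multiset.coe_nodup, Multiset.sort_eq]; exact hnd
    exact (h1.and h2).imp fun h => lt_of_le_of_ne h.1 h.2.symm
  refine Finset.card_le_card_of_injOn (fun p => if h : (p.parts.sort (· ≥ ·)).Pairwise (· > ·) then
    ⟨p.parts.sort (· ≥ ·), h, fun a ha => p.parts_pos ((Multiset.mem_sort _).1 ha)⟩
    else StrictPartition.empty) ?_ ?_
  · intro p hp
    have h := hsort p hp
    simp only [h, dif_pos, mem_coe, mem_SP, StrictPartition.size]
    rw [← Multiset.sum_coe, Multiset.sort_eq, p.parts_sum]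
  · intro p hp q hq e
    simp only [hsort p hp, hsort q hq, dif_pos, StrictPartition.mk.injEq] at e
    ext1
    rw [← Multiset.sort_eq p.parts (· ≥ ·), e, Multiset.sort_eq]

theorem sum_map_toMultiset (m : ℕ →₀ ℕ) :
    ((Finsupp.toMultiset m).map fun j => 2 * j + 1).sum = oddWeight m := by
  induction m using Finsupp.induction_linear with
  | zero => simp
  | add a b ha hb => rw [map_add, Multiset.map_add, Multiset.sum_add, ha, hb, map_add]
  | single j e => simp [oddWeight, Finsupp.weight_single, Multiset.map_nsmul, Multiset.sum_nsmul]

/-- The odd partition that belongs to a monomial in the odd power sums. -/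
noncomputable def monomialPartition (n : ℕ) (m : {m // oddWeight m < n}) :
    Σ k : Fin n, {p : Nat.Partition k // p ∈ Nat.Partition.odds k} :=
  ⟨⟨oddWeight m, m.2⟩, ⟨⟨(Finsupp.toMultiset m.1).map fun j => 2 * j + 1, by
      intro i hi
      obtain ⟨j, -, rfl⟩ := Multiset.mem_map.1 hi
      omega, by
      exact sum_map_toMultiset m.1⟩, by
      simp only [Nat.Partition.odds, Nat.Partition.restricted, mem_filter, mem_univ, true_and]
      intro i hi
      obtain ⟨j, -, rfl⟩ := Multiset.mem_map.1 hi
      simp⟩⟩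

theorem monomialPartition_injective (n : ℕ) : Function.Injective (monomialPartition n) := by
  intro m m' h
  have h1 : (Finsupp.toMultiset m.1).map (fun j => 2 * j + 1) =
      (Finsupp.toMultiset m'.1).map fun j => 2 * j + 1 :=
    congrArg (fun q : Σ k : Fin n, {p : Nat.Partition k // p ∈ Nat.Partition.odds k} =>
      q.2.1.parts) h
  have h2 := Multiset.map_injective (fun a b (hab : 2 * a + 1 = 2 * b + 1) => by omega) h1
  exact Subtype.ext ((Finsupp.orderIsoMultiset (ι := ℕ)).injective h2)

instance finite_monomials (n : ℕ) : Finite {m : ℕ →₀ ℕ // oddWeight m < n} :=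
  Finite.of_injective _ (monomialPartition_injective n)

/-- Monomials in the odd power sums correspond to odd partitions; Euler's theorem converts these
into partitions with distinct parts. -/
theorem card_monomials_le (n : ℕ) :
    Nat.card {m : ℕ →₀ ℕ // oddWeight m < n} ≤ (partitionsLT n).card := by
  refine (Nat.card_le_card_of_injective _ (monomialPartition_injective n)).trans ?_
  rw [Nat.card_eq_fintype_card, Fintype.card_sigma, card_partitionsLT, Finset.sum_range]
  refine Finset.sum_le_sum fun k _ => ?_
  rw [Fintype.card_coe, Nat.Partition.card_odds_eq_card_distincts]
  exact card_distincts_le k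

/-! ### The bases of factorial and ordinary Schur P-functions -/

theorem linearIndependent_facP : LinearIndependent ℚ facP :=
  LinearIndependent.of_comp evalAll linearIndependent_evalAll_facP

theorem weightLT_eq_span (n : ℕ) :
    weightLT n = Submodule.span ℚ (facP '' {lam | lam.size < n}) := by
  have hf : Finite ({m : ℕ →₀ ℕ | oddWeight m < n} : Set (ℕ →₀ ℕ)) := finite_monomials n
  let b := MvPolynomial.basisRestrictSupport ℚ {m : ℕ →₀ ℕ | oddWeight m < n}
  have hfin : Module.Finite ℚ (weightLT n) := Module.Finite.of_basis b
  have hrank : Module.finrank ℚ (weightLT n) ≤ (partitionsLT n).card := by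
    have h1 : Module.finrank ℚ (weightLT n) = Nat.card {m : ℕ →₀ ℕ // oddWeight m < n} :=
      Module.finrank_eq_nat_card_basis b
    rw [h1]
    exact card_monomials_le n
  have himg : (facP '' {lam | lam.size < n}) = Set.range fun lam : partitionsLT n => facP lam := by
    ext g
    simp [mem_partitionsLT]
  symm
  refine Submodule.eq_of_le_of_finrank_le ?_ ?_
  · rw [Submodule.span_le]
    rintro _ ⟨lam, hlam, rfl⟩
    exact weightLT_mono hlam (facP_mem lam)
  · rw [himg, finrank_span_eq_card (b := fun lam : partitionsLT n => facP lam)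
        (linearIndependent_facP.comp _ Subtype.val_injective),
      Fintype.card_coe]
    exact hrank

theorem span_facP : Submodule.span ℚ (Set.range facP) = ⊤ := by
  rw [eq_top_iff]
  intro g _
  obtain ⟨n, hn⟩ := exists_mem_weightLT g
  rw [weightLT_eq_span] at hn
  exact Submodule.span_mono (Set.image_subset_range _ _) hn

/-- The basis of factorial Schur `P`-functions. -/
noncomputable def facBasis : Module.Basis StrictPartition ℚ OddPower :=
  Module.Basis.mk linearIndependent_facP span_facP.ge

theorem facBasis_apply (lam : StrictPartition) : facBasis lam = facP lam := by simp [facBasis]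

theorem eq_zero_of_evalPart {g : OddPower} (h : ∀ lam, evalPart lam g = 0) : g = 0 := by
  have h1 : Finsupp.linearCombination ℚ (fun nu => evalAll (facP nu)) (facBasis.repr g) = 0 := by
    have e := congrArg evalAll (facBasis.linearCombination_repr g)
    rw [Finsupp.apply_linearCombination] at e
    have : (evalAll ∘ facBasis) = fun nu => evalAll (facP nu) := by
      funext nu; simp [facBasis_apply]
    rw [this] at e
    rw [e]
    exact funext h
  have h2 := (linearIndependent_iff.1 linearIndependent_evalAll_facP) _ h1
  exact facBasis.repr.map_eq_zero_iff.1 h2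

theorem toSeq_injective : Function.Injective toSeq := by
  rw [injective_iff_map_eq_zero]
  intro g hg
  refine eq_zero_of_evalPart fun lam => ?_
  rw [evalPart, ← evalAt_toSeq, hg]
  simp [evalAt]

/-- The isomorphism of `OddPower` with `Γ`. -/
noncomputable def gamEquiv : OddPower ≃ₐ[ℚ] Gam :=
  (AlgEquiv.ofInjective toSeq toSeq_injective).trans (Subalgebra.equivOfEq _ _ range_toSeq)

theorem coe_gamEquiv (g : OddPower) : (gamEquiv g : PolySeq) = toSeq g := rfl

/-! ### The isomorphism between factorial and ordinary Schur `P`-functions -/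

/-- The linear map that sends factorial Schur `P`-functions to Schur `P`-functions. -/
noncomputable def defactorialize : OddPower →ₗ[ℚ] OddPower :=
  facBasis.constr ℚ fun lam => powP lam.parts

theorem defactorialize_facP (lam : StrictPartition) :
    defactorialize (facP lam) = powP lam.parts := by
  rw [← facBasis_apply, defactorialize, Module.Basis.constr_basis]

theorem defactorialize_sub_mem {n : ℕ} {g : OddPower} (hg : g ∈ weightLT (n + 1)) :
    defactorialize g - g ∈ weightLT n := by
  rw [weightLT_eq_span] at hg
  have : Submodule.span ℚ (facP '' {lam | lam.size < n + 1}) ≤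
      (weightLT n).comap (defactorialize - LinearMap.id) := by
    rw [Submodule.span_le]
    rintro _ ⟨lam, hlam, rfl⟩
    rw [SetLike.mem_coe, Submodule.mem_comap, LinearMap.sub_apply, defactorialize_facP,
      LinearMap.id_apply]
    exact weightLT_mono (Nat.lt_succ_iff.1 hlam) (powP_sub_mem lam.pos)
  exact this hg

/-- The map differs from the identity by terms of lower weight. A kernel element therefore descends
through the filtration to zero, and a preimage is found by correcting `g` by a preimage of the
error. -/
theorem defactorialize_bijective : Function.Bijective defactorialize := by
  constructor
  · rw [injective_iff_map_eq_zero]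
    intro g hg
    obtain ⟨n, hn⟩ := exists_mem_weightLT g
    induction n with
    | zero => exact eq_zero_of_mem_weightLT_zero hn
    | succ n ih =>
      have h := defactorialize_sub_mem hn
      rw [hg, zero_sub] at h
      exact ih ((Submodule.neg_mem_iff _).1 h)
  · intro g
    obtain ⟨n, hn⟩ := exists_mem_weightLT g
    induction n generalizing g with
    | zero => exact ⟨0, by rw [map_zero, eq_zero_of_mem_weightLT_zero hn]⟩
    | succ n ih =>
      obtain ⟨f, hf⟩ := ih _ (defactorialize_sub_mem hn)
      exact ⟨g - f, by rw [map_sub, hf]; abel⟩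

/-- The linear isomorphism that sends Schur `P`-functions to factorial Schur `P`-functions. -/
noncomputable def factorialize : OddPower ≃ₗ[ℚ] OddPower :=
  (LinearEquiv.ofBijective defactorialize defactorialize_bijective).symm

theorem factorialize_powP (lam : StrictPartition) : factorialize (powP lam.parts) = facP lam := by
  rw [factorialize, LinearEquiv.symm_apply_eq]
  exact (defactorialize_facP lam).symm

/-- The basis of Schur `P`-functions. -/
noncomputable def powBasis : Module.Basis StrictPartition ℚ OddPower :=
  facBasis.map factorialize.symm

theorem powBasis_apply (lam : StrictPartition) : powBasis lam = powP lam.parts := by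
  rw [powBasis, Module.Basis.map_apply, facBasis_apply, ← factorialize_powP,
    LinearEquiv.symm_apply_apply]

theorem powP_repeat {p s : List ℕ} {x : ℕ} (hpos : ∀ y ∈ p ++ x :: x :: s, 0 < y) :
    powP (p ++ x :: x :: s) = 0 := by
  refine eq_zero_of_evalPart fun lam => ?_
  rw [evalPart, powP, evalList_rowProduct _ lam.nodup_cast]
  · rw [List.map_append, List.map_cons, List.map_cons]
    generalize (lam.parts.map fun x : ℕ => (x : ℚ)) = xs
    clear hpos
    induction p generalizing xs with
    | nil => exact rowSum_cons_self_cons _ _ _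
    | cons y p ih =>
      rw [List.map_cons, List.cons_append, rowSum, ← pick_zero (M := ℚ) xs]
      exact pick_congr fun z zs _ => by rw [ih, mul_zero]
  · intro v hv
    obtain ⟨k, hk, rfl⟩ := List.mem_map.1 hv
    exact dvd_pow_self _ (hpos k hk).ne'


/-! ### The covering relation of strict partitions -/

namespace StrictPartition

theorem part_eq_getElem (lam : StrictPartition) {i : ℕ} (h : i < lam.parts.length) :
    lam.part i = lam.parts[i] := by
  simp [part, h]

theorem part_pos_iff (lam : StrictPartition) (i : ℕ) : 0 < lam.part i ↔ i < lam.length := by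
  by_cases h : i < lam.parts.length
  · rw [lam.part_eq_getElem h]
    exact iff_of_true (lam.pos _ (List.getElem_mem h)) h
  · simp [part, length, not_lt.1 h]

theorem part_succ_lt (lam : StrictPartition) {i : ℕ} (h : 0 < lam.part i) :
    lam.part (i + 1) < lam.part i := by
  have h1 : i < lam.parts.length := (lam.part_pos_iff i).1 h
  by_cases h2 : i + 1 < lam.parts.length
  · rw [lam.part_eq_getElem h1, lam.part_eq_getElem h2]
    exact List.pairwise_iff_getElem.1 lam.decreasing i (i + 1) h1 h2 (Nat.lt_succ_self i)
  · have h3 : lam.part (i + 1) = 0 := by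
      by_contra h3
      exact h2 ((lam.part_pos_iff _).1 (Nat.pos_of_ne_zero h3))
    omega

theorem ext_part {lam mu : StrictPartition} (h : ∀ i, lam.part i = mu.part i) : lam = mu := by
  have hl : ∀ i, i < lam.length ↔ i < mu.length := fun i => by
    rw [← part_pos_iff, ← part_pos_iff, h]
  have hlen : lam.length = mu.length :=
    le_antisymm (not_lt.1 fun h' => lt_irrefl _ ((hl _).1 h'))
      (not_lt.1 fun h' => lt_irrefl _ ((hl _).2 h'))
  refine StrictPartition.ext (List.ext_getElem hlen fun i h1 h2 => ?_)
  rw [← lam.part_eq_getElem h1, ← mu.part_eq_getElem h2, h]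

theorem mem_diagram (lam : StrictPartition) (i j : ℕ) :
    (i, j) ∈ lam.diagram ↔ i ≤ j ∧ j < lam.part i + i := by
  simp only [diagram, Set.mem_ofPred_eq]
  rw [← part_pos_iff]
  constructor
  · exact fun h => h.2
  · exact fun h => ⟨by omega, h⟩

/-- The diagram of `lam` arises from that of `mu` by adding one box. -/
def Covers (lam mu : StrictPartition) : Prop :=
  ∃ b : ℕ × ℕ, b ∉ mu.diagram ∧ lam.diagram = insert b mu.diagram

/-- The part with index `i` of `lam` exceeds that of `mu` by one and the other parts agree. -/
def IsStep (lam mu : StrictPartition) (i : ℕ) : Prop :=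
  ∀ j, lam.part j = mu.part j + if j = i then 1 else 0

theorem covers_iff {lam mu : StrictPartition} : Covers lam mu ↔ ∃ i, IsStep lam mu i := by
  constructor
  · rintro ⟨⟨r, c⟩, hb, h⟩
    have key : ∀ i j, (i ≤ j ∧ j < lam.part i + i) ↔
        (i = r ∧ j = c) ∨ (i ≤ j ∧ j < mu.part i + i) := by
      intro i j
      rw [← mem_diagram, h, Set.mem_insert_iff, mem_diagram, Prod.mk.injEq]
    rw [mem_diagram] at hb
    refine ⟨r, fun i => ?_⟩
    split_ifs with hi
    · subst hi
      -- These columns force `c` to be the first free column of the row of `mu` and the row of `lam`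
      -- to end there.
      have h1 := key i c
      have h2 := key i (mu.part i + i)
      have h3 := key i (c + 1)
      simp only [true_and, true_or, iff_true] at h1 h2 h3
      omega
    · have h1 := key i (lam.part i + i)
      have h2 := key i (mu.part i + i)
      simp only [hi, false_and, false_or] at h1 h2
      omega
  · rintro ⟨r, h⟩
    refine ⟨(r, mu.part r + r), by rw [mem_diagram]; omega, Set.ext fun ⟨i, j⟩ => ?_⟩
    rw [Set.mem_insert_iff, mem_diagram, mem_diagram, h, Prod.mk.injEq]
    by_cases hi : i = r
    · subst hi; simp only [if_true, true_and]; omega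
    · simp [hi]

theorem IsStep.unique_left {lam lam' mu : StrictPartition} {i : ℕ} (h : IsStep lam mu i)
    (h' : IsStep lam' mu i) : lam = lam' :=
  ext_part fun j => by rw [h j, h' j]

theorem IsStep.unique_right {lam mu mu' : StrictPartition} {i : ℕ} (h : IsStep lam mu i)
    (h' : IsStep lam mu' i) : mu = mu' :=
  ext_part fun j => by have h1 := h j; have h2 := h' j; omega

theorem IsStep.lt_length {lam mu : StrictPartition} {i : ℕ} (h : IsStep lam mu i) :
    i < lam.length := by
  rw [← part_pos_iff, h i, if_pos rfl]
  omega

theorem IsStep.le_length {lam mu : StrictPartition} {i : ℕ} (h : IsStep lam mu i) :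
    i ≤ mu.length := by
  rcases i with _ | i
  · exact Nat.zero_le _
  · have h1 := h.lt_length
    have h2 : 0 < lam.part i := (part_pos_iff _ _).2 (by omega)
    rw [h i, if_neg (by omega), add_zero, part_pos_iff] at h2
    exact h2

theorem size_eq_sum_part (lam : StrictPartition) {n : ℕ} (h : lam.length ≤ n) :
    lam.size = ∑ i ∈ range n, lam.part i := by
  have h1 : lam.size = ∑ i ∈ range lam.length, lam.part i := by
    rw [size, length, Finset.sum_range, ← List.sum_ofFn]
    congr 1
    refine List.ext_getElem (by simp) fun i h1 h2 => ?_
    rw [List.getElem_ofFn, part_eq_getElem _ h1]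
  rw [h1]
  refine Finset.sum_subset (range_mono h) fun i _ hi => ?_
  by_contra h0
  exact hi (mem_range.2 ((part_pos_iff _ _).1 (Nat.pos_of_ne_zero h0)))

theorem Covers.size_eq {lam mu : StrictPartition} (h : Covers lam mu) :
    lam.size = mu.size + 1 := by
  obtain ⟨i, h⟩ := covers_iff.1 h
  set n := lam.length + mu.length + 1
  rw [lam.size_eq_sum_part (n := n) (by omega), mu.size_eq_sum_part (n := n) (by omega),
    Finset.sum_congr rfl fun j _ => h j, Finset.sum_add_distrib, Finset.sum_ite_eq', if_pos]
  have := h.lt_length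
  rw [mem_range]
  omega

/-- The strict partitions that arise by removing one box. -/
noncomputable def lowerCovers (lam : StrictPartition) : Finset StrictPartition :=
  @Finset.filter _ (fun mu => Covers lam mu) (Classical.decPred _) (SP (lam.size - 1))

/-- The strict partitions that arise by adding one box. -/
noncomputable def upperCovers (mu : StrictPartition) : Finset StrictPartition :=
  @Finset.filter _ (fun lam => Covers lam mu) (Classical.decPred _) (SP (mu.size + 1))

theorem mem_lowerCovers {lam mu : StrictPartition} : mu ∈ lowerCovers lam ↔ Covers lam mu := by
  classical
  rw [lowerCovers, mem_filter, mem_SP, and_iff_right_iff_imp]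
  intro h
  have := h.size_eq
  omega

theorem mem_upperCovers {lam mu : StrictPartition} : lam ∈ upperCovers mu ↔ Covers lam mu := by
  classical
  rw [upperCovers, mem_filter, mem_SP, and_iff_right_iff_imp]
  exact fun h => h.size_eq

end StrictPartition

open StrictPartition

theorem modify_append_cons (s : ℕ → ℕ) (p q : List ℕ) (a : ℕ) :
    (p ++ a :: q).modify p.length s = p ++ s a :: q := by
  induction p with
  | nil => rfl
  | cons x p ih => simpa using ih

theorem isStep_of_parts {lam mu : StrictPartition} {p q : List ℕ} {a : ℕ}
    (hlam : lam.parts = p ++ (a + 1) :: q) (hmu : mu.parts = p ++ a :: q) :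
    IsStep lam mu p.length := by
  intro j
  rw [part, part, hlam, hmu]
  clear hlam hmu
  induction p generalizing j with
  | nil => rcases j with _ | j <;> simp
  | cons x p ih =>
    rcases j with _ | j
    · simp
    · simpa using ih j

theorem isStep_of_append_one {lam mu : StrictPartition} (h : lam.parts = mu.parts ++ [1]) :
    IsStep lam mu mu.length := by
  intro j
  rw [part, part, h, length]
  generalize mu.parts = p
  induction p generalizing j with
  | nil => rcases j with _ | j <;> simp
  | cons x p ih =>
    rcases j with _ | j
    · simp
    · simpa using ih j

theorem exists_eq_append_cons {l : List ℕ} {i : ℕ} (h : i < l.length) :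
    ∃ p a q, l = p ++ a :: q ∧ p.length = i :=
  ⟨l.take i, l[i], l.drop (i + 1), by simp, by simp [h.le]⟩

/-- A list that arises by lowering a part is a strict partition, possibly with a zero appended, or
has two equal neighbours. -/
theorem lower_cases (lam : StrictPartition) {i : ℕ} (hi : i < lam.length) :
    (∃ mu, IsStep lam mu i ∧ ((lam.parts.modify i Nat.pred = mu.parts ∧ lam.length = mu.length) ∨
      (lam.parts.modify i Nat.pred = mu.parts ++ [0] ∧ lam.length = mu.length + 1))) ∨
    ((∀ mu, ¬ IsStep lam mu i) ∧ ∃ p x s, lam.parts.modify i Nat.pred = p ++ x :: x :: s ∧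
      ∀ y ∈ p ++ x :: x :: s, 0 < y) := by
  obtain ⟨p, a, q, h, rfl⟩ := exists_eq_append_cons hi
  have hdec := lam.decreasing
  have hpos := lam.pos
  have hlen : lam.length = (p ++ a :: q).length := by rw [← h]; rfl
  rw [h, modify_append_cons]
  rw [h] at hdec hpos
  obtain ⟨b, rfl⟩ := Nat.exists_eq_succ_of_ne_zero (hpos a (by simp)).ne'
  rw [Nat.pred_succ]
  rw [List.pairwise_append, List.pairwise_cons] at hdec
  obtain ⟨hp, ⟨hbq, hq⟩, hpq⟩ := hdec
  have valid : (∀ z ∈ q, z < b) → 0 < b → ∃ mu, IsStep lam mu p.length ∧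
      ((p ++ b :: q = mu.parts ∧ lam.length = mu.length) ∨
      (p ++ b :: q = mu.parts ++ [0] ∧ lam.length = mu.length + 1)) := by
    intro hb hb0
    refine ⟨⟨p ++ b :: q, ?_, ?_⟩, isStep_of_parts h rfl, Or.inl ⟨rfl, by rw [hlen]; simp [StrictPartition.length]⟩⟩
    · rw [List.pairwise_append, List.pairwise_cons]
      refine ⟨hp, ⟨hb, hq⟩, fun x hx y hy => ?_⟩
      rcases List.mem_cons.1 hy with rfl | hy
      · have := hpq x hx (y + 1) (by simp)
        omega
      · exact hpq x hx y (by simp [hy])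
    · intro x hx
      rcases List.mem_append.1 hx with hx | hx
      · exact hpos x (by simp [hx])
      · rcases List.mem_cons.1 hx with rfl | hx
        · exact hb0
        · exact hpos x (by simp [hx])
  rcases q with _ | ⟨c, q⟩
  · left
    rcases Nat.eq_zero_or_pos b with rfl | hb
    · exact ⟨⟨p, hp, fun x hx => hpos x (by simp [hx])⟩, isStep_of_append_one h,
        Or.inr ⟨rfl, by rw [hlen]; simp [StrictPartition.length]⟩⟩
    · exact valid (by simp) hb
  · have hcb : c < b + 1 := hbq c (by simp)
    have hc := hpos c (by simp)
    rcases Nat.lt_succ_iff_lt_or_eq.1 hcb with hlt | rfl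
    · left
      refine valid (fun z hz => ?_) (by omega)
      rcases List.mem_cons.1 hz with rfl | hz
      · exact hlt
      · exact ((List.pairwise_cons.1 hq).1 z hz).trans hlt
    · refine Or.inr ⟨fun mu hmu => ?_, p, c, q, rfl, fun y hy => hpos y ?_⟩
      · have h1 := hmu p.length
        have h2 := hmu (p.length + 1)
        rw [if_pos rfl] at h1
        rw [if_neg (by omega)] at h2
        have e1 : lam.part p.length = c + 1 := by simp [part, h]
        have e2 : lam.part (p.length + 1) = c := by simp [part, h]
        have := mu.part_succ_lt (i := p.length) (by omega)
        omega
      · simp only [List.mem_append, List.mem_cons] at hy ⊢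
        tauto

/-- A list that arises by raising the part of index `i`, or by appending a part `1` if `i` is the
length, is a strict partition or has two equal neighbours. -/
theorem raise_cases (mu : StrictPartition) {p q : List ℕ} {a : ℕ}
    (h : mu.parts = p ++ a :: q ∨ (mu.parts = p ∧ q = [] ∧ a = 0)) :
    (∃ lam, IsStep lam mu p.length ∧ lam.parts = p ++ (a + 1) :: q) ∨
    ((∀ lam, ¬ IsStep lam mu p.length) ∧ ∃ p' x s, p ++ (a + 1) :: q = p' ++ x :: x :: s ∧
      ∀ y ∈ p ++ (a + 1) :: q, 0 < y) := by
  have hp : p.Pairwise (· > ·) := by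
    rcases h with h | h
    · exact (List.pairwise_append.1 (h ▸ mu.decreasing)).1
    · exact h.1 ▸ mu.decreasing
  have hq : q.Pairwise (· > ·) ∧ ∀ z ∈ q, z < a := by
    rcases h with h | h
    · obtain ⟨h1, h2⟩ := List.pairwise_cons.1 (List.pairwise_append.1 (h ▸ mu.decreasing)).2.1
      exact ⟨h2, h1⟩
    · simp [h.2.1]
  have hpa : ∀ z ∈ p, a < z := by
    rcases h with h | h
    · exact fun z hz => (List.pairwise_append.1 (h ▸ mu.decreasing)).2.2 z hz a (by simp)
    · exact fun z hz => h.2.2 ▸ mu.pos z (h.1 ▸ hz)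
  have hpos : ∀ y ∈ p ++ (a + 1) :: q, 0 < y := by
    intro y hy
    simp only [List.mem_append, List.mem_cons] at hy
    rcases hy with hy | rfl | hy
    · have := hpa y hy
      omega
    · omega
    · rcases h with h | h
      · exact mu.pos y (by simp [h, hy])
      · simp [h.2.1] at hy
  -- Used for k = 0 and k = 1: the part to be raised and the one above it, with a missing part read
  -- as 0.
  have hpart : ∀ k, mu.part (p.length - k) = (p ++ [a]).getD (p.length - k) 0 := by
    intro k
    rcases h with h | h
    · have e : p ++ a :: q = (p ++ [a]) ++ q := by simp
      rw [part, h, e, List.getD_append _ _ _ _ (by simp)]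
    · rw [part, h.1, h.2.2]
      rcases lt_or_ge (p.length - k) p.length with h1 | h1
      · rw [List.getD_append _ _ _ _ h1]
      · rw [List.getD_eq_default _ _ h1, show p.length - k = p.length by omega]
        simp
  by_cases hlast : ∀ z ∈ p, a + 1 < z
  · left
    refine ⟨⟨p ++ (a + 1) :: q, ?_, hpos⟩, ?_, rfl⟩
    · rw [List.pairwise_append, List.pairwise_cons]
      refine ⟨hp, ⟨fun z hz => (hq.2 z hz).trans (Nat.lt_succ_self a), hq.1⟩, fun x hx y hy => ?_⟩
      rcases List.mem_cons.1 hy with rfl | hy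
      · exact hlast x hx
      · exact (hq.2 y hy).trans (hpa x hx)
    · rcases h with h | ⟨h, rfl, rfl⟩
      · exact isStep_of_parts rfl h
      · subst h
        exact isStep_of_append_one rfl
  · right
    rcases p.eq_nil_or_concat' with rfl | ⟨p', z, rfl⟩
    · simp at hlast
    · have hz : z = a + 1 := by
        by_contra hz
        refine hlast fun y hy => ?_
        have hza := hpa z (by simp)
        rcases List.mem_append.1 hy with hy | hy
        · have := (List.pairwise_append.1 hp).2.2 y hy z (by simp)
          omega
        · rw [List.mem_singleton] at hy
          omega
      subst hz
      refine ⟨fun lam hlam => ?_, p', a + 1, q, by simp, hpos⟩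
      have h0 := hpart 0
      have h1 := hpart 1
      rw [List.length_append, List.length_singleton] at hlam h0 h1
      simp only [Nat.sub_zero, Nat.add_sub_cancel] at h0 h1
      have e0 : mu.part (p'.length + 1) = a := by rw [h0]; simp
      have e1 : mu.part p'.length = a + 1 := by rw [h1]; simp
      have s0 := hlam (p'.length + 1)
      have s1 := hlam p'.length
      rw [if_pos rfl] at s0
      rw [if_neg (by omega)] at s1
      have := lam.part_succ_lt (i := p'.length) (by omega)
      omega

section Sums

variable {M : Type*} [AddCommMonoid M]

/-- The part in which `lam` differs from `mu`. -/
noncomputable def stepIndex (lam mu : StrictPartition) : ℕ := by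
  classical exact if h : ∃ i, IsStep lam mu i then h.choose else 0

theorem isStep_stepIndex {lam mu : StrictPartition} (h : Covers lam mu) :
    IsStep lam mu (stepIndex lam mu) := by
  have h' := covers_iff.1 h
  rw [stepIndex, dif_pos h']
  exact h'.choose_spec

theorem StrictPartition.IsStep.covers {lam mu : StrictPartition} {i : ℕ} (h : IsStep lam mu i) : Covers lam mu :=
  covers_iff.2 ⟨i, h⟩

theorem StrictPartition.IsStep.index_eq {lam mu : StrictPartition} {i j : ℕ} (h : IsStep lam mu i)
    (h' : IsStep lam mu j) : i = j := by
  by_contra hne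
  have h1 := h i
  have h2 := h' i
  rw [if_pos rfl] at h1
  rw [if_neg hne] at h2
  omega

/-- The right-hand side lowers every row, also where this is not allowed; there two neighbours
coincide and `hrep` removes the term. Lowering a last part 1 leaves a zero, which is why `hdrop` is
separate. -/
theorem sum_lowerCovers (lam : StrictPartition) {F : List ℕ → M} {f : StrictPartition → M}
    (hrep : ∀ p x s, (∀ y ∈ p ++ x :: x :: s, 0 < y) → F (p ++ x :: x :: s) = 0)
    (hsame : ∀ mu, Covers lam mu → lam.length = mu.length → F mu.parts = f mu)
    (hdrop : ∀ mu, Covers lam mu → lam.length = mu.length + 1 → F (mu.parts ++ [0]) = f mu) :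
    ∑ mu ∈ lowerCovers lam, f mu = stepSum Nat.pred F lam.parts := by
  rw [stepSum_eq_sum]
  refine Finset.sum_of_injOn (stepIndex lam) ?_ ?_ ?_ ?_
  · intro mu hmu mu' hmu' e
    have h1 := isStep_stepIndex (mem_lowerCovers.1 hmu)
    have h2 := isStep_stepIndex (mem_lowerCovers.1 hmu')
    rw [← e] at h2
    exact h1.unique_right h2
  · intro mu hmu
    exact mem_range.2 (isStep_stepIndex (mem_lowerCovers.1 hmu)).lt_length
  · intro i hi himg
    rcases lower_cases lam (mem_range.1 hi) with ⟨mu, hmu, -⟩ | ⟨-, p, x, s, e, hpos⟩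
    · refine absurd ⟨mu, mem_lowerCovers.2 hmu.covers, ?_⟩ himg
      exact (isStep_stepIndex hmu.covers).index_eq hmu
    · rw [e, hrep p x s hpos]
  · intro mu hmu
    have hcov := mem_lowerCovers.1 hmu
    have h := isStep_stepIndex hcov
    rcases lower_cases lam h.lt_length with ⟨mu', hmu', hc⟩ | ⟨hno, -⟩
    · obtain rfl := h.unique_right hmu'
      rcases hc with ⟨e, hl⟩ | ⟨e, hl⟩
      · rw [e, hsame mu hcov hl]
      · rw [e, hdrop mu hcov hl]
    · exact absurd h (hno mu)

theorem sum_upperCovers (mu : StrictPartition) {F : List ℕ → M}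
    (hrep : ∀ p x s, (∀ y ∈ p ++ x :: x :: s, 0 < y) → F (p ++ x :: x :: s) = 0) :
    ∑ lam ∈ upperCovers mu, F lam.parts = stepSum Nat.succ F mu.parts + F (mu.parts ++ [1]) := by
  -- The index ℓ(μ) stands for opening a new row.
  set g : ℕ → M := fun i =>
    if i < mu.length then F (mu.parts.modify i Nat.succ) else F (mu.parts ++ [1]) with hg
  have hsum : stepSum Nat.succ F mu.parts + F (mu.parts ++ [1]) =
      ∑ i ∈ range (mu.length + 1), g i := by
    rw [stepSum_eq_sum, Finset.sum_range_succ]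
    congr 1
    · exact Finset.sum_congr rfl fun i hi => (if_pos (mem_range.1 hi)).symm
    · simp [hg]
  have hcases : ∀ i, i ≤ mu.length → ∃ l, g i = F l ∧
      ((∃ lam, IsStep lam mu i ∧ lam.parts = l) ∨ ((∀ lam, ¬ IsStep lam mu i) ∧ F l = 0)) := by
    intro i hi
    rcases hi.lt_or_eq with hi | rfl
    · obtain ⟨p, a, q, h, rfl⟩ := exists_eq_append_cons hi
      refine ⟨p ++ (a + 1) :: q, by rw [hg]; simp only; rw [if_pos hi, h, modify_append_cons], ?_⟩
      rcases raise_cases mu (Or.inl h) with h1 | ⟨h1, p', x, s, e, hpos⟩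
      · exact Or.inl h1
      · exact Or.inr ⟨h1, by rw [e] at hpos ⊢; exact hrep p' x s hpos⟩
    · refine ⟨mu.parts ++ [1], by simp [hg], ?_⟩
      rcases raise_cases mu (p := mu.parts) (Or.inr ⟨rfl, rfl, rfl⟩) with
        h1 | ⟨h1, p', x, s, e, hpos⟩
      · exact Or.inl h1
      · refine Or.inr ⟨h1, ?_⟩
        rw [zero_add] at e hpos
        rw [e] at hpos ⊢
        exact hrep p' x s hpos
  rw [hsum]
  refine Finset.sum_of_injOn (fun lam => stepIndex lam mu) ?_ ?_ ?_ ?_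
  · intro lam hlam lam' hlam' e
    have h1 := isStep_stepIndex (mem_upperCovers.1 hlam)
    have h2 := isStep_stepIndex (mem_upperCovers.1 hlam')
    simp only at e
    rw [← e] at h2
    exact h1.unique_left h2
  · intro lam hlam
    exact mem_range.2 (Nat.lt_succ_of_le (isStep_stepIndex (mem_upperCovers.1 hlam)).le_length)
  · intro i hi himg
    obtain ⟨l, hl, ⟨lam, hlam, -⟩ | ⟨-, h0⟩⟩ := hcases i (Nat.lt_succ_iff.1 (mem_range.1 hi))
    · exact absurd ⟨lam, mem_upperCovers.2 hlam.covers,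
        (isStep_stepIndex hlam.covers).index_eq hlam⟩ himg
    · rw [hl, h0]
  · intro lam hlam
    have h := isStep_stepIndex (mem_upperCovers.1 hlam)
    obtain ⟨l, hl, ⟨lam', hlam', rfl⟩ | ⟨hno, -⟩⟩ := hcases _ h.le_length
    · obtain rfl := h.unique_left hlam'
      exact hl.symm
    · exact absurd h (hno lam)

end Sums

/-! ### Counting standard tableaux -/

theorem isStandardTableau_succ {lam mu : StrictPartition} {k : ℕ}
    (t : Fin (k + 1 + 1) → StrictPartition) :
    IsStandardTableau lam mu t ↔ t (Fin.last (k + 1)) = lam ∧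
      Covers lam (t (Fin.last k).castSucc) ∧
      IsStandardTableau (t (Fin.last k).castSucc) mu fun i => t i.castSucc := by
  unfold IsStandardTableau Covers
  rw [Fin.forall_fin_succ']
  constructor
  · rintro ⟨h0, h1, h2, h3⟩
    refine ⟨h1, ?_, h0, rfl, fun i => ?_⟩
    · rw [← h1]; exact h3
    · exact h2 i
  · rintro ⟨h1, h3, h0, -, h2⟩
    refine ⟨h0, h1, fun i => h2 i, ?_⟩
    rw [← h1] at h3; exact h3

theorem snoc_bijective (lam mu : StrictPartition) (k : ℕ) :
    Function.Bijective (fun q : Σ kap : {kap // kap ∈ lowerCovers lam},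
        {t : Fin (k + 1) → StrictPartition // IsStandardTableau kap.1 mu t} =>
      (⟨Fin.snoc (α := fun _ => StrictPartition) q.2.1 lam, by
        rw [isStandardTableau_succ]
        simp only [Fin.snoc_last, Fin.snoc_castSucc, q.2.2.2.1, true_and]
        exact ⟨mem_lowerCovers.1 q.1.2, q.2.2⟩⟩ :
        {t : Fin (k + 1 + 1) → StrictPartition // IsStandardTableau lam mu t})) := by
  constructor
  · rintro ⟨⟨kap, hkap⟩, ⟨t, ht⟩⟩ ⟨⟨kap', hkap'⟩, ⟨t', ht'⟩⟩ h
    have e : t = t' := by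
      have h1 := congrArg (fun s : {t : Fin (k + 1 + 1) → StrictPartition //
        IsStandardTableau lam mu t} => Fin.init (α := fun _ => StrictPartition) s.1) h
      simpa only [Fin.init_snoc] using h1
    subst e
    obtain rfl : kap = kap' := ht.2.1.symm.trans ht'.2.1
    rfl
  · rintro ⟨t, ht⟩
    obtain ⟨h1, h2, h3⟩ := (isStandardTableau_succ t).1 ht
    refine ⟨⟨⟨_, mem_lowerCovers.2 h2⟩, ⟨_, h3⟩⟩, Subtype.ext ?_⟩
    subst h1
    exact Fin.snoc_init_self (α := fun _ => StrictPartition) t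

instance finite_standardTableau (lam mu : StrictPartition) (k : ℕ) :
    Finite {t : Fin (k + 1) → StrictPartition // IsStandardTableau lam mu t} := by
  induction k generalizing lam with
  | zero =>
    refine @Finite.of_subsingleton _ ⟨fun t t' => Subtype.ext (funext fun i => ?_)⟩
    obtain rfl : i = 0 := Fin.ext (by omega)
    rw [t.2.1, t'.2.1]
  | succ k ih => exact Finite.of_surjective _ (snoc_bijective lam mu k).2

theorem card_standardTableau_succ (lam mu : StrictPartition) (k : ℕ) :
    Nat.card {t : Fin (k + 1 + 1) → StrictPartition // IsStandardTableau lam mu t} =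
      ∑ kap ∈ lowerCovers lam,
        Nat.card {t : Fin (k + 1) → StrictPartition // IsStandardTableau kap mu t} := by
  rw [← Nat.card_congr (Equiv.ofBijective _ (snoc_bijective lam mu k)), Nat.card_sigma]
  exact Finset.sum_coe_sort (lowerCovers lam) fun kap =>
    Nat.card {t : Fin (k + 1) → StrictPartition // IsStandardTableau kap mu t}

theorem gSkew_self (lam : StrictPartition) : gSkew lam lam = 1 := by
  rw [gSkew, Nat.sub_self, Nat.card_eq_one_iff_unique]
  refine ⟨⟨fun t t' => Subtype.ext (funext fun i => ?_)⟩, ⟨⟨fun _ => lam, rfl, rfl, fun i => i.elim0⟩⟩⟩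
  obtain rfl : i = 0 := Fin.ext (by omega)
  rw [t.2.1, t'.2.1]

theorem gSkew_eq_zero {lam mu : StrictPartition} (hne : lam ≠ mu) (hle : lam.size ≤ mu.size) :
    gSkew lam mu = 0 := by
  rw [gSkew, Nat.sub_eq_zero_of_le hle]
  have : IsEmpty {t : Fin (0 + 1) → StrictPartition // IsStandardTableau lam mu t} :=
    ⟨fun t => hne (t.2.2.1.symm.trans t.2.1)⟩
  exact Nat.card_of_isEmpty

theorem gSkew_eq_sum {lam mu : StrictPartition} (h : mu.size < lam.size) :
    gSkew lam mu = ∑ kap ∈ lowerCovers lam, gSkew kap mu := by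
  obtain ⟨k, hk⟩ := Nat.exists_eq_add_of_lt h
  rw [gSkew, show lam.size - mu.size = k + 1 by omega, card_standardTableau_succ]
  refine Finset.sum_congr rfl fun kap hkap => ?_
  have := (mem_lowerCovers.1 hkap).size_eq
  rw [gSkew, show kap.size - mu.size = k by omega]


/-! ### Adding and removing boxes -/

/-- The weight `2 ^ (1 - ℓ(λ) + ℓ(μ))` of adding a box to `μ`. -/
noncomputable def boxWeight (mu lam : StrictPartition) : ℚ :=
  (2 : ℚ) ^ (1 - (lam.length : ℤ) + (mu.length : ℤ))

theorem boxWeight_of_eq {mu lam : StrictPartition} (h : lam.length = mu.length) :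
    boxWeight mu lam = 2 := by
  rw [boxWeight, h, sub_add_cancel, zpow_one]

theorem boxWeight_of_eq_succ {mu lam : StrictPartition} (h : lam.length = mu.length + 1) :
    boxWeight mu lam = 1 := by
  rw [boxWeight, h]
  simp

/-- Every lowering has weight 2, but a row that disappears leaves a zero row worth 1/2. -/
theorem pderiv_powP_parts (lam : StrictPartition) :
    MvPolynomial.pderiv 0 (powP lam.parts) =
      ∑ kap ∈ lowerCovers lam, boxWeight kap lam • powP kap.parts := by
  rw [pderiv_powP lam.pos, sum_lowerCovers lam (F := fun l => (2 : ℚ) • powP l)]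
  · exact (stepSum_map_hom (DistribSMul.toAddMonoidHom OddPower (2 : ℚ)) Nat.pred powP lam.parts).symm
  · intro p x s h
    rw [powP_repeat h, smul_zero]
  · intro kap _ h
    rw [boxWeight_of_eq h]
  · intro kap _ h
    rw [boxWeight_of_eq_succ h, powP_append_zero, smul_smul]
    norm_num

theorem X_zero_mul_powP_parts (mu : StrictPartition) :
    MvPolynomial.X 0 * powP mu.parts = ∑ lam ∈ upperCovers mu, powP lam.parts := by
  rw [X_zero_mul_powP, sum_upperCovers mu fun _ _ _ h => powP_repeat h]

theorem sum_lowerCovers_factorialValue (nu lam : StrictPartition) :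
    ∑ kap ∈ lowerCovers lam, factorialValue nu.parts kap.parts =
      ((lam.size : ℚ) - nu.size) * factorialValue nu.parts lam.parts := by
  rw [sum_lowerCovers lam (F := factorialValue nu.parts)]
  · exact stepSum_factorialValue nu.parts lam.nodup lam.pos
  · exact fun p x s _ => factorialValue_repeat nu.parts p s x
  · exact fun _ _ _ => rfl
  · exact fun kap _ _ => factorialValue_append_zero nu.pos kap.pos

theorem factorialValue_eq_zero {nu lam : StrictPartition} (hne : lam ≠ nu)
    (hle : lam.size ≤ nu.size) : factorialValue nu.parts lam.parts = 0 := by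
  by_contra h
  exact hne (StrictPartition.ext
    (eq_of_factorialValue_ne_zero nu.decreasing lam.decreasing lam.pos hle h))

/-- Both sides satisfy the recursion over the last box, where the factor |λ| - |ν| builds up the
factorial, and both are a Kronecker delta at equal sizes. -/
theorem gSkew_eq_factorialValue {nu lam : StrictPartition} {j : ℕ} (h : lam.size = nu.size + j) :
    (gSkew lam nu : ℚ) = (j.factorial : ℚ) * factorialValue nu.parts lam.parts := by
  induction j generalizing lam with
  | zero =>
    by_cases e : lam = nu
    · subst e
      rw [gSkew_self, factorialValue_self lam.decreasing]
      simp
    · rw [gSkew_eq_zero e h.le, factorialValue_eq_zero e h.le]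
      simp
  | succ j ih =>
    have hs := sum_lowerCovers_factorialValue nu lam
    rw [h] at hs
    rw [gSkew_eq_sum (by omega), Nat.cast_sum, Finset.sum_congr rfl fun kap hkap => ih (by
      have := (mem_lowerCovers.1 hkap).size_eq
      omega), ← Finset.mul_sum, hs, Nat.factorial_succ]
    push_cast
    ring

theorem gStd_eq_hookWeight (lam : StrictPartition) :
    (gStd lam : ℚ) = (lam.size.factorial : ℚ) * hookWeight lam.parts :=
  gSkew_eq_factorialValue (nu := StrictPartition.empty) (by simp [StrictPartition.empty, size])

theorem sum_SP_upperCovers {M : Type*} [AddCommMonoid M] (n : ℕ)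
    (f : StrictPartition → StrictPartition → M) :
    ∑ mu ∈ SP n, ∑ lam ∈ upperCovers mu, f mu lam =
      ∑ lam ∈ SP (n + 1), ∑ mu ∈ lowerCovers lam, f mu lam := by
  refine Finset.sum_comm' fun mu lam => ?_
  rw [mem_SP, mem_SP, mem_upperCovers, mem_lowerCovers]
  constructor
  · rintro ⟨h1, h2⟩
    exact ⟨h2, by rw [h2.size_eq, h1]⟩
  · rintro ⟨h2, h1⟩
    refine ⟨?_, h2⟩
    have := h2.size_eq
    omega

theorem X_zero_pow_mul_powP (nu : StrictPartition) (j : ℕ) :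
    MvPolynomial.X 0 ^ j * powP nu.parts =
      ∑ lam ∈ SP (nu.size + j), (gSkew lam nu : ℚ) • powP lam.parts := by
  induction j with
  | zero =>
    rw [pow_zero, one_mul, add_zero, Finset.sum_eq_single_of_mem nu (mem_SP.2 rfl), gSkew_self]
    · simp
    · intro lam hlam hne
      rw [gSkew_eq_zero hne (mem_SP.1 hlam).le, Nat.cast_zero, zero_smul]
  | succ j ih =>
    rw [pow_succ', mul_assoc, ih, Finset.mul_sum]
    have h1 : ∀ mu ∈ SP (nu.size + j), MvPolynomial.X 0 * ((gSkew mu nu : ℚ) • powP mu.parts) =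
        ∑ lam ∈ upperCovers mu, (gSkew mu nu : ℚ) • powP lam.parts := by
      intro mu _
      rw [mul_smul_comm, X_zero_mul_powP_parts, Finset.smul_sum]
    rw [Finset.sum_congr rfl h1, sum_SP_upperCovers, ← add_assoc]
    refine Finset.sum_congr rfl fun lam hlam => ?_
    rw [mem_SP] at hlam
    rw [← Finset.sum_smul, gSkew_eq_sum (by omega), Nat.cast_sum]

theorem powP_coeff_eq {n : ℕ} {a b : StrictPartition → ℚ}
    (h : ∑ mu ∈ SP n, a mu • powP mu.parts = ∑ mu ∈ SP n, b mu • powP mu.parts)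
    {mu : StrictPartition} (hmu : mu.size = n) : a mu = b mu := by
  have hli := linearIndependent_iff'.1 powBasis.linearIndependent (SP n) (fun mu => a mu - b mu) (by
    simp only [powBasis_apply, sub_smul, Finset.sum_sub_distrib, h, sub_self])
  exact sub_eq_zero.1 (hli mu (mem_SP.2 hmu))

/-- The commutation relation of adding and removing boxes. -/
theorem sum_upperCovers_gSkew {mu nu : StrictPartition} {j : ℕ} (h : mu.size + 1 = nu.size + j) :
    ∑ lam ∈ upperCovers mu, boxWeight mu lam * (gSkew lam nu : ℚ) =
      (j : ℚ) * gSkew mu nu + ∑ kap ∈ lowerCovers nu, boxWeight kap nu * (gSkew mu kap : ℚ) := by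
  -- Differentiate the expansion of p_1^j P_ν: the Leibniz rule yields the two terms of the
  -- right-hand side, and the claim is the coefficient of P_μ.
  have hD := congrArg (MvPolynomial.pderiv 0) (X_zero_pow_mul_powP nu j)
  rw [Derivation.leibniz, Derivation.leibniz_pow, MvPolynomial.pderiv_X, Pi.single_eq_same,
    pderiv_powP_parts, map_sum, ← h] at hD
  have hR : ∀ lam ∈ SP (mu.size + 1), MvPolynomial.pderiv 0 ((gSkew lam nu : ℚ) • powP lam.parts) =
      ∑ kap ∈ lowerCovers lam, (boxWeight kap lam * (gSkew lam nu : ℚ)) • powP kap.parts := by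
    intro lam _
    rw [Derivation.map_smul, pderiv_powP_parts, Finset.smul_sum]
    exact Finset.sum_congr rfl fun kap _ => by rw [smul_smul, mul_comm]
  rw [Finset.sum_congr rfl hR, ← sum_SP_upperCovers] at hD
  simp only [← Finset.sum_smul] at hD
  have h1 : (MvPolynomial.X 0 : OddPower) ^ j • ∑ kap ∈ lowerCovers nu, boxWeight kap nu • powP kap.parts =
      ∑ lam ∈ SP mu.size, (∑ kap ∈ lowerCovers nu, boxWeight kap nu * (gSkew lam kap : ℚ)) •
        powP lam.parts := by
    simp only [smul_eq_mul, Finset.sum_smul]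
    rw [Finset.mul_sum, Finset.sum_comm]
    refine Finset.sum_congr rfl fun kap hkap => ?_
    have := (mem_lowerCovers.1 hkap).size_eq
    rw [mul_smul_comm, X_zero_pow_mul_powP, show kap.size + j = mu.size by omega, Finset.smul_sum]
    exact Finset.sum_congr rfl fun lam _ => by rw [smul_smul]
  have h2 : powP nu.parts • j • ((MvPolynomial.X 0 : OddPower) ^ (j - 1) • (1 : OddPower)) =
      ∑ lam ∈ SP mu.size, ((j : ℚ) * gSkew lam nu) • powP lam.parts := by
    rcases j with _ | j
    · simp
    · have e : powP nu.parts • (j + 1) • ((MvPolynomial.X 0 : OddPower) ^ (j + 1 - 1) • (1 : OddPower)) =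
          ((j + 1 : ℕ) : ℚ) • (MvPolynomial.X 0 ^ j * powP nu.parts) := by
        rw [Nat.add_sub_cancel, Nat.cast_smul_eq_nsmul, smul_eq_mul, smul_eq_mul, mul_one,
          mul_smul_comm, mul_comm]
      rw [e, X_zero_pow_mul_powP, show nu.size + j = mu.size by omega, Finset.smul_sum]
      exact Finset.sum_congr rfl fun lam _ => by rw [smul_smul]
  rw [h1, h2, ← Finset.sum_add_distrib] at hD
  simp only [← add_smul] at hD
  rw [← powP_coeff_eq hD rfl, add_comm]

/-- Dividing the commutation relation by j! removes the factor j, since the tableaux of shape μ/ν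
have only j - 1 boxes. If |μ| + 1 < |ν|, every term vanishes. -/
theorem sum_upperCovers_factorialValue (mu nu : StrictPartition) :
    ∑ lam ∈ upperCovers mu, boxWeight mu lam * factorialValue nu.parts lam.parts =
      factorialValue nu.parts mu.parts +
        ∑ kap ∈ lowerCovers nu, boxWeight kap nu * factorialValue kap.parts mu.parts := by
  rcases lt_or_ge (mu.size + 1) nu.size with hlt | hge
  · have hz : ∀ {a b : StrictPartition}, b.size < a.size → factorialValue a.parts b.parts = 0 :=
      fun h => factorialValue_eq_zero (fun e => by subst e; exact lt_irrefl _ h) h.le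
    rw [Finset.sum_eq_zero, hz (by omega), Finset.sum_eq_zero, add_zero]
    · intro kap hkap
      have := (mem_lowerCovers.1 hkap).size_eq
      rw [hz (by omega), mul_zero]
    · intro lam hlam
      have := (mem_upperCovers.1 hlam).size_eq
      rw [hz (by omega), mul_zero]
  · obtain ⟨j, hj⟩ := Nat.exists_eq_add_of_le hge
    have h := sum_upperCovers_gSkew hj
    have hf : (j.factorial : ℚ) ≠ 0 := by positivity
    have h1 : ∑ lam ∈ upperCovers mu, boxWeight mu lam * (gSkew lam nu : ℚ) = (j.factorial : ℚ) *
        ∑ lam ∈ upperCovers mu, boxWeight mu lam * factorialValue nu.parts lam.parts := by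
      rw [Finset.mul_sum]
      refine Finset.sum_congr rfl fun lam hlam => ?_
      have := (mem_upperCovers.1 hlam).size_eq
      rw [gSkew_eq_factorialValue (j := j) (by omega)]
      ring
    have h2 : ∑ kap ∈ lowerCovers nu, boxWeight kap nu * (gSkew mu kap : ℚ) = (j.factorial : ℚ) *
        ∑ kap ∈ lowerCovers nu, boxWeight kap nu * factorialValue kap.parts mu.parts := by
      rw [Finset.mul_sum]
      refine Finset.sum_congr rfl fun kap hkap => ?_
      have := (mem_lowerCovers.1 hkap).size_eq
      rw [gSkew_eq_factorialValue (j := j) (by omega)]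
      ring
    have h3 : (j : ℚ) * gSkew mu nu = (j.factorial : ℚ) * factorialValue nu.parts mu.parts := by
      -- For j = 0 the left side has the factor 0, and the right side vanishes because |μ| < |ν|.
      rcases j with _ | j
      · rw [factorialValue_eq_zero (fun e => by subst e; omega) (by omega)]
        simp
      · rw [gSkew_eq_factorialValue (j := j) (by omega), Nat.factorial_succ]
        push_cast
        ring
    rw [h1, h2, h3, ← mul_add] at h
    exact mul_left_cancel₀ hf h

/-! ### The Markov chain -/

/-- The average of `φ` after adding one box to `μ`. -/
noncomputable def oneStep (φ : StrictPartition → ℚ) (mu : StrictPartition) : ℚ :=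
  ∑ lam ∈ upperCovers mu, hookWeight lam.parts / hookWeight mu.parts * boxWeight mu lam * φ lam

/-- By linearity it suffices to take f = P_ν; after multiplication by the hook weight of μ this is
`sum_upperCovers_factorialValue`. -/
theorem oneStep_evalPart (f : OddPower) (mu : StrictPartition) :
    oneStep (fun lam => evalPart lam (factorialize f)) mu =
      evalPart mu (factorialize f) + evalPart mu (factorialize (MvPolynomial.pderiv 0 f)) := by
  let L : OddPower →ₗ[ℚ] ℚ := ∑ lam ∈ upperCovers mu,
    (hookWeight lam.parts / hookWeight mu.parts * boxWeight mu lam) •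
      ((evalPart lam).toLinearMap.comp factorialize.toLinearMap)
  let R : OddPower →ₗ[ℚ] ℚ := (evalPart mu).toLinearMap.comp factorialize.toLinearMap +
    ((evalPart mu).toLinearMap.comp factorialize.toLinearMap).comp
      (MvPolynomial.pderiv (R := ℚ) (0 : ℕ)).toLinearMap
  have hLR : L = R := by
    refine powBasis.ext fun nu => ?_
    have hmu := (hookWeight_pos mu.decreasing).ne'
    refine mul_right_cancel₀ hmu ?_
    have hL : L (powBasis nu) * hookWeight mu.parts =
        ∑ lam ∈ upperCovers mu, boxWeight mu lam * factorialValue nu.parts lam.parts := by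
      simp only [L, powBasis_apply, LinearMap.sum_apply, LinearMap.smul_apply, LinearMap.comp_apply,
        LinearEquiv.coe_coe, factorialize_powP, AlgHom.toLinearMap_apply, smul_eq_mul]
      rw [Finset.sum_mul]
      refine Finset.sum_congr rfl fun lam _ => ?_
      rw [← evalPart_facP_mul_hookWeight]
      field_simp
    have hR : R (powBasis nu) * hookWeight mu.parts = factorialValue nu.parts mu.parts +
        ∑ kap ∈ lowerCovers nu, boxWeight kap nu * factorialValue kap.parts mu.parts := by
      simp only [R, powBasis_apply, LinearMap.add_apply, LinearMap.comp_apply,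
        LinearEquiv.coe_coe, factorialize_powP, AlgHom.toLinearMap_apply,
        Derivation.coeFn_coe, pderiv_powP_parts, map_sum, map_smul, smul_eq_mul]
      rw [add_mul, evalPart_facP_mul_hookWeight, Finset.sum_mul]
      congr 1
      refine Finset.sum_congr rfl fun kap _ => ?_
      rw [mul_assoc, evalPart_facP_mul_hookWeight]
    rw [hL, hR, sum_upperCovers_factorialValue]
  have := DFunLike.congr_fun hLR f
  simpa [L, R, LinearMap.sum_apply, oneStep] using this

theorem plancherelWeight_eq {mu lam : StrictPartition} {n : ℕ} (h : lam.size = n + mu.size) :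
    plancherelWeight mu n lam = hookWeight lam.parts / hookWeight mu.parts *
      (2 : ℚ) ^ ((n : ℤ) - (lam.length : ℤ) + (mu.length : ℤ)) * (gSkew lam mu : ℚ) := by
  have h1 : ((n + mu.size).factorial : ℚ) ≠ 0 := by positivity
  have h2 : (mu.size.factorial : ℚ) ≠ 0 := by positivity
  have h3 := (hookWeight_pos mu.decreasing).ne'
  rw [plancherelWeight, gStd_eq_hookWeight, gStd_eq_hookWeight, h]
  field_simp

theorem average_zero (mu : StrictPartition) (φ : StrictPartition → ℚ) :
    average mu 0 φ = φ mu := by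
  rw [average, Finset.sum_eq_single_of_mem mu (mem_SP.2 (zero_add _).symm),
    plancherelWeight_eq (zero_add _).symm, gSkew_self, div_self (hookWeight_pos mu.decreasing).ne']
  · simp
  · intro lam hlam hne
    rw [mem_SP] at hlam
    rw [plancherelWeight_eq hlam, gSkew_eq_zero hne (by omega)]
    simp

/-- The Markov property: g^{λ/μ} splits according to the last box, the quotients of hook weights
telescope and the exponents of 2 add up. -/
theorem average_succ (mu : StrictPartition) (n : ℕ) (φ : StrictPartition → ℚ) :
    average mu (n + 1) φ = average mu n (oneStep φ) := by
  rw [average, average]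
  simp only [oneStep, Finset.mul_sum]
  rw [sum_SP_upperCovers, show n + 1 + mu.size = n + mu.size + 1 by omega]
  refine Finset.sum_congr rfl fun lam hlam => ?_
  rw [mem_SP] at hlam
  rw [plancherelWeight_eq (by omega), gSkew_eq_sum (by omega), Nat.cast_sum, Finset.mul_sum,
    Finset.sum_mul]
  refine Finset.sum_congr rfl fun kap hkap => ?_
  have hs := (mem_lowerCovers.1 hkap).size_eq
  rw [plancherelWeight_eq (n := n) (by omega), boxWeight]
  have h3 := (hookWeight_pos kap.decreasing).ne'
  have hpow : (2 : ℚ) ^ (((n + 1 : ℕ) : ℤ) - (lam.length : ℤ) + (mu.length : ℤ)) =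
      (2 : ℚ) ^ ((n : ℤ) - (kap.length : ℤ) + (mu.length : ℤ)) *
        (2 : ℚ) ^ (1 - (lam.length : ℤ) + (kap.length : ℤ)) := by
    rw [← zpow_add₀ two_ne_zero]
    congr 1
    push_cast
    ring
  rw [hpow]
  field_simp

theorem average_evalPart {f : OddPower} (hf : MvPolynomial.pderiv 0 f = 0) (mu : StrictPartition)
    (n : ℕ) : average mu n (fun lam => evalPart lam (factorialize f)) =
      evalPart mu (factorialize f) := by
  induction n with
  | zero => exact average_zero mu _
  | succ n ih =>
    rw [average_succ]
    have : oneStep (fun lam => evalPart lam (factorialize f)) =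
        fun lam => evalPart lam (factorialize f) := by
      funext lam
      rw [oneStep_evalPart, hf, map_zero, map_zero, add_zero]
    rw [this, ih]

theorem plancherelWeight_nonneg (mu : StrictPartition) (n : ℕ) (lam : StrictPartition) :
    0 ≤ plancherelWeight mu n lam := by
  unfold plancherelWeight
  positivity

theorem sum_plancherelWeight (mu : StrictPartition) (n : ℕ) :
    ∑ lam ∈ SP (n + mu.size), plancherelWeight mu n lam = 1 := by
  have h1 : factorialize 1 = 1 := factorialize_powP StrictPartition.empty
  have h := average_evalPart (f := 1) (Derivation.map_one_eq_zero _) mu n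
  simpa [average, h1] using h

/-! ### The isomorphism of `Γ` -/

theorem schurP_eq (lam : StrictPartition) : schurP lam = toSeq (powP lam.parts) :=
  schurSeq_eq_toSeq (fun _ hk => dvd_pow_self _ hk.ne') lam

theorem factorialSchurP_eq (lam : StrictPartition) : factorialSchurP lam = toSeq (facP lam) :=
  schurSeq_eq_toSeq (fun _ hk => X_dvd_descPochhammer hk) lam

/-- The P_λ form a basis, so the condition determines Ψ everywhere, as the transport of
`factorialize` to Γ. -/
theorem sendsPToFactorialP_iff {Psi : Gam ≃ₗ[ℚ] Gam} :
    SendsPToFactorialP Psi ↔ ∀ f, Psi (gamEquiv f) = gamEquiv (factorialize f) := by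
  constructor
  · intro h
    have key : (Psi.toLinearMap.comp gamEquiv.toLinearMap) =
        gamEquiv.toLinearMap.comp factorialize.toLinearMap := by
      refine powBasis.ext fun lam => ?_
      obtain ⟨hmem, e⟩ := h lam
      have h1 : gamEquiv (powP lam.parts) = ⟨schurP lam, hmem⟩ :=
        Subtype.ext (schurP_eq lam).symm
      refine Subtype.ext ?_
      simp only [powBasis_apply, LinearMap.comp_apply, LinearEquiv.coe_coe,
        AlgEquiv.toLinearMap_apply, factorialize_powP, h1]
      rw [e, factorialSchurP_eq, coe_gamEquiv]
    exact fun f => DFunLike.congr_fun key f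
  · intro h lam
    have hmem : schurP lam ∈ Gam := by
      rw [schurP_eq]
      exact (gamEquiv (powP lam.parts)).2
    refine ⟨hmem, ?_⟩
    have h1 : gamEquiv (powP lam.parts) = ⟨schurP lam, hmem⟩ :=
      Subtype.ext (schurP_eq lam).symm
    rw [← h1, h, factorialize_powP, factorialSchurP_eq, coe_gamEquiv]

theorem existsUnique_sendsPToFactorialP : ∃! Psi : Gam ≃ₗ[ℚ] Gam, SendsPToFactorialP Psi := by
  refine ⟨gamEquiv.toLinearEquiv.symm.trans (factorialize.trans gamEquiv.toLinearEquiv),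
    sendsPToFactorialP_iff.2 fun f => by simp, fun Psi hPsi => ?_⟩
  have h := sendsPToFactorialP_iff.1 hPsi
  refine LinearEquiv.ext fun g => ?_
  obtain ⟨f, rfl⟩ := gamEquiv.surjective g
  rw [h]
  simp

/-- The product of power sums `p_ρ` as an element of `OddPower`. -/
noncomputable def oddMonomial (rho : OddPartition) : OddPower :=
  (rho.parts.map fun r => (MvPolynomial.X (r / 2) : OddPower)).prod

theorem gamEquiv_oddMonomial (rho : OddPartition) : gamEquiv (oddMonomial rho) = oddPowerSum rho := by
  refine Subtype.ext ?_
  rw [coe_gamEquiv, oddMonomial, oddPowerSum, map_multiset_prod, Multiset.map_map]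
  congr 1
  refine Multiset.map_congr rfl fun r hr => ?_
  have := Nat.two_mul_div_two_add_one_of_odd (rho.odd r hr)
  simp [toSeq, this]

theorem pderiv_oddMonomial {rho : OddPartition} (h : 1 ∉ rho.parts) :
    MvPolynomial.pderiv 0 (oddMonomial rho) = 0 := by
  have hodd := rho.odd
  rw [oddMonomial]
  generalize rho.parts = s at h hodd
  induction s using Multiset.induction_on with
  | empty => simp
  | cons r s ih =>
    have hr : r / 2 ≠ 0 := by
      obtain ⟨m, rfl⟩ := hodd r (by simp)
      have : (2 * m + 1) ≠ 1 := fun e => h (by simp [e])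
      omega
    rw [Multiset.map_cons, Multiset.prod_cons, Derivation.leibniz,
      ih (fun h' => h (by simp [h'])) (fun q hq => hodd q (by simp [hq])), MvPolynomial.pderiv_X,
      Pi.single_eq_of_ne hr]
    simp

end ShiftedPlancherel

theorem theorem4p2 :
    (∃! Psi : Gam ≃ₗ[ℚ] Gam, SendsPToFactorialP Psi) ∧
    (∀ Psi : Gam ≃ₗ[ℚ] Gam, SendsPToFactorialP Psi →
      ∀ (mu : StrictPartition) (n : ℕ) (rho : OddPartition), 1 ∉ rho.parts →
        average mu n (fun lam => evalAt (Psi (oddPowerSum rho)) lam) = evalAt (Psi (oddPowerSum rho)) mu) ∧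
    (∀ (mu : StrictPartition) (n : ℕ),
      (∀ lam ∈ SP (n + mu.size), 0 ≤ plancherelWeight mu n lam) ∧
        ∑ lam ∈ SP (n + mu.size), plancherelWeight mu n lam = 1) := by
  refine ⟨existsUnique_sendsPToFactorialP, fun Psi hPsi mu n rho hrho => ?_, fun mu n =>
    ⟨fun lam _ => plancherelWeight_nonneg mu n lam, sum_plancherelWeight mu n⟩⟩
  have h : ∀ lam, evalAt (Psi (oddPowerSum rho)) lam =
      evalPart lam (factorialize (oddMonomial rho)) := fun lam => by
    rw [← gamEquiv_oddMonomial, sendsPToFactorialP_iff.1 hPsi, coe_gamEquiv, evalAt_toSeq, evalPart]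
  simp only [h]
  exact average_evalPart (pderiv_oddMonomial hrho) mu n
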